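/- Consider the binary erasure channel $Y_k=X_kE_k$, $k\in\mathbb Z$, where the input $X=(X_k)_{k\in\mathbb Z}$ is a stationary process with values in $\{1,2\}$ and the erasure process $E=(E_k)_{k\in\mathbb Z}$ is independent of $X$ and i.i.d. with $P(E_k=0)=\varepsilon=1-P(E_k=1)$, $\varepsilon\in[0,1]$. Let $\mathcal S_0$ be the $(1,\infty)$-RLL constraint, i.e. the set of all finite words over $\{1,2\}$ that do not contain $22$ as a contiguous subword; $X$ is supported on $\mathcal S_0$ if every finite word that $X$ takes with positive probability lies in $\mathcal S_0$. Let $$I(X;Y)=\lim_{n\to\infty}\frac1n I(X_1^n;Y_1^n)$$ be the mutual information rate (natural logarithms), let $C(\mathcal S_0,\varepsilon)$ be the supremum of $I(X;Y)$ over all stationary $X$ supported on $\mathcal S_0$, and for $n\ge1$ let $C^{(n)}(\mathcal S_0,\varepsilon)$ be the supremum of $I(X;Y)$ over all stationary $n$-th order Markov chains $X$ supported on $\mathcal S_0$. (The limit exists for each such $X$, and the suprema are over nonempty bounded sets.) Let $\lambda=(1+\sqrt5)/2$. Then, as $\varepsilon\to0$, $$C(\mathcal S_0,\varepsilon)=\log\lambda-\frac{2\log2}{1+\lambda^2}\,\varepsilon+O(\varepsilon^2),$$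 and for every $n\ge1$, $$C^{(n)}(\mathcal S_0,\varepsilon)=\log\lambda-\frac{2\log2}{1+\lambda^2}\,\varepsilon+O(\varepsilon^2),$$ where the constant in $O(\varepsilon^2)$ may depend on $n$. -/

import Mathlib

open MeasureTheory Filter Topology Asymptotics

namespace ErasureChannel

noncomputable section

/-- The input alphabet `{1, …, K}`, as the nonzero elements of the output alphabet `{0, …, K}`. -/
abbrev Input (K : ℕ) : Type := {k : Fin (K + 1) // k ≠ 0}

/-- The output alphabet `{0, 1, …, K}`; the letter `0` is an erasure. -/
abbrev Output (K : ℕ) : Type := Fin (K + 1)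

/-- The channel output `x · e` for the input letter `x` and `e ∈ {0, 1}`. -/
def output {K : ℕ} (x : Input K) (e : Fin 2) : Output K := if e = 0 then 0 else x.1

/-- The word `x_i x_{i+1} … x_{i+n-1}` of a two-sided sequence. -/
def word {A : Type*} (x : ℤ → A) (i : ℤ) (n : ℕ) : List A :=
  List.ofFn fun k : Fin n => x (i + (k : ℕ))

/-- The words over `A` that contain no word of `F` as a contiguous subsequence. -/
def finiteTypeConstraint {A : Type*} (F : Set (List A)) : Set (List A) :=
  {w | ∀ f ∈ F, ¬ f <:+: w}

/-- The `(1, ∞)`-RLL constraint over `{1, 2}`: the word `22` is forbidden. -/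
def rll : Set (List (Input 2)) :=
  finiteTypeConstraint {[⟨2, by decide⟩, ⟨2, by decide⟩]}

section Law

/-! A process with time set `ℤ` is given by its law, a probability measure `P` on `ℤ → A`. -/

variable {A : Type*} [MeasurableSpace A]

/-- Stationarity: the law is invariant under the shift. -/
def IsStationary (P : Measure (ℤ → A)) : Prop :=
  MeasurePreserving (fun (x : ℤ → A) (k : ℤ) => x (k + 1)) P P

/-- The probability that the process spells the word `w` from time `i` on. -/
def wordProb (P : Measure (ℤ → A)) (i : ℤ) (w : List A) : ℝ :=
  P.real {x | word x i w.length = w}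

/-- The set of the words that occur with positive probability. -/
def words (P : Measure (ℤ → A)) : Set (List A) :=
  {w | ∃ i : ℤ, 0 < wordProb P i w}

/-- The process is an `m`-th order Markov chain: given the past `u v` with `|v| = m`, the
conditional law of the next letter `a` depends on `v` only, that is,
`P(a | u v) = P(a | v)` (written without quotients). -/
def IsMarkov (m : ℕ) (P : Measure (ℤ → A)) : Prop :=
  ∀ (i : ℤ) (u v : List A) (a : A), v.length = m →
    wordProb P i (u ++ v ++ [a]) * wordProb P (i + u.length) v =
      wordProb P i (u ++ v) * wordProb P (i + u.length) (v ++ [a])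

end Law

/-- Shannon entropy (natural logarithm) of a law on a finite set. -/
def entropy {T : Type*} [Fintype T] [MeasurableSpace T] (μ : Measure T) : ℝ :=
  ∑ t, Real.negMulLog (μ.real {t})

/-- The law of the erasure process: independent `E_n` with `P(E_n = 0) = ε = 1 - P(E_n = 1)`. -/
def erasureLaw (ε : unitInterval) : Measure (ℤ → Fin 2) :=
  Measure.infinitePi fun _ => ProbabilityTheory.bernoulliMeasure (0 : Fin 2) 1 ε

/-- The joint law of the input process, with law `P`, and the erasure process, which are
independent. -/
def jointLaw {K : ℕ} (P : Measure (ℤ → Input K)) (ε : unitInterval) :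
    Measure ((ℤ → Input K) × (ℤ → Fin 2)) :=
  P.prod (erasureLaw ε)

/-- The input block `X_1, …, X_n`. -/
def inputBlock {K : ℕ} (n : ℕ) (ω : (ℤ → Input K) × (ℤ → Fin 2)) : Fin n → Input K :=
  fun k => ω.1 ((k : ℕ) + 1)

/-- The output block `Y_1, …, Y_n`, where `Y_k = X_k E_k`. -/
def outputBlock {K : ℕ} (n : ℕ) (ω : (ℤ → Input K) × (ℤ → Fin 2)) : Fin n → Output K :=
  fun k => output (ω.1 ((k : ℕ) + 1)) (ω.2 ((k : ℕ) + 1))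

/-- The mutual information `I(X_1^n; Y_1^n) = H(X_1^n) + H(Y_1^n) - H(X_1^n, Y_1^n)`. -/
def blockInfo {K : ℕ} (P : Measure (ℤ → Input K)) (ε : unitInterval) (n : ℕ) : ℝ :=
  entropy ((jointLaw P ε).map (inputBlock n)) + entropy ((jointLaw P ε).map (outputBlock n))
    - entropy ((jointLaw P ε).map fun ω => (inputBlock n ω, outputBlock n ω))

/-- The mutual information rate `I(X; Y) = lim (1/n) I(X_1^n; Y_1^n)`. -/
def infoRate {K : ℕ} (P : Measure (ℤ → Input K)) (ε : unitInterval) : ℝ :=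
  limUnder atTop fun n : ℕ => blockInfo P ε n / n

/-- `P` is the law of a stationary input process supported on `S`. -/
structure IsInput {K : ℕ} (S : Set (List (Input K))) (P : Measure (ℤ → Input K)) : Prop where
  isProbabilityMeasure : IsProbabilityMeasure P
  isStationary : IsStationary P
  words_subset : words P ⊆ S

/-- The rates `I(X; Y)` of all stationary input processes supported on `S`. -/
def rates {K : ℕ} (S : Set (List (Input K))) (ε : unitInterval) : Set ℝ :=
  {r | ∃ P : Measure (ℤ → Input K), IsInput S P ∧ infoRate P ε = r}

/-- The rates `I(X; Y)` of all stationary `m`-th order Markov chains supported on `S`. -/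
def markovRates {K : ℕ} (m : ℕ) (S : Set (List (Input K))) (ε : unitInterval) : Set ℝ :=
  {r | ∃ P : Measure (ℤ → Input K), IsInput S P ∧ IsMarkov m P ∧ infoRate P ε = r}

/-- The capacity `C(S, ε)`. -/
def capacity {K : ℕ} (S : Set (List (Input K))) (ε : unitInterval) : ℝ :=
  sSup (rates S ε)

/-- The `m`-th order Markov capacity `C^{(m)}(S, ε)`. -/
def markovCapacity {K : ℕ} (m : ℕ) (S : Set (List (Input K))) (ε : unitInterval) : ℝ :=
  sSup (markovRates m S ε)

end

end ErasureChannel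

/-!
The erasure pattern can be read off the output, so `I(X_1^n; Y_1^n)` is the mean, over the random
set of unerased positions, of the entropy of `X` restricted to that set. The entropies of finite
restrictions form a stationary polymatroid, which suffices to bound this mean: from above by the
conditional entropy of a letter given the unerased ones among the two letters before it, from below
by the entropy of the whole block minus the conditional entropy, at each erased position, given its
unerased neighbours.

With no erasure the maximal entropy rate is `log φ`, attained by the golden mean Markov chain.
Any other input loses entropy at least quadratically in the defect of its transition statistics
against that chain, while the coefficient of `ε` changes at most linearly in the defect, so that
maximizing over the defect costs only `O(ε²)`. For the lower bound the golden mean chain itself is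
used. It is realized on `ℤ` as a function of independent bits: the letter at time `k` is determined
by the parity of the run of zeros that ends at `k`.
-/

namespace ErasureChannel

noncomputable section

section Entropy

theorem negMulLog_le_neg_mul_log_add_sub {p q : ℝ} (hp : 0 ≤ p) (hq : 0 ≤ q) (h : q = 0 → p = 0) :
    Real.negMulLog p ≤ -(p * Real.log q) + (q - p) := by
  rcases hp.eq_or_lt with rfl | hp0
  · simpa using hq
  have hq0 : 0 < q := hq.lt_of_ne fun h0 => hp0.ne' (h h0.symm)
  have hlog : p * Real.log (q / p) ≤ p * (q / p - 1) := by
    gcongr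
    exact Real.log_le_sub_one_of_pos (by positivity)
  rw [Real.log_div hq0.ne' hp0.ne', mul_sub, mul_sub, mul_div_cancel₀ _ hp0.ne'] at hlog
  rw [Real.negMulLog]
  linarith

theorem negMulLog_le_neg_mul_log_add_sub_sub_sq {p q : ℝ} (hp : p ∈ Set.Icc (0 : ℝ) 1)
    (hq : q ∈ Set.Icc (0 : ℝ) 1) (h : q = 0 → p = 0) :
    Real.negMulLog p ≤ -(p * Real.log q) + (q - p) - (p - q) ^ 2 / 4 := by
  rcases hp.1.eq_or_lt with rfl | hp0
  · simp only [Real.negMulLog_zero]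
    nlinarith [hq.1, hq.2]
  have hq0 : 0 < q := hq.1.lt_of_ne fun h0 => hp0.ne' (h h0.symm)
  -- For `p = a²`, `q = b²`, the bound `log x ≤ x - 1` at `x = b / a` leaves a remainder `(a - b)²`.
  obtain ⟨a, ha, rfl⟩ : ∃ a : ℝ, 0 < a ∧ a ^ 2 = p := ⟨√p, by positivity, Real.sq_sqrt hp.1⟩
  obtain ⟨b, hb, rfl⟩ : ∃ b : ℝ, 0 < b ∧ b ^ 2 = q := ⟨√q, by positivity, Real.sq_sqrt hq.1⟩
  have hlog : a ^ 2 * Real.log (b / a) ≤ a ^ 2 * (b / a - 1) := by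
    gcongr
    exact Real.log_le_sub_one_of_pos (by positivity)
  have hquot : a ^ 2 * (b / a - 1) = a * b - a ^ 2 := by field_simp
  rw [hquot, Real.log_div hb.ne' ha.ne'] at hlog
  have hsq : (a ^ 2 - b ^ 2) ^ 2 ≤ 4 * (a - b) ^ 2 := by
    have hadd : (a + b) ^ 2 ≤ 4 := by nlinarith [hp.2, hq.2, sq_nonneg (a - b)]
    nlinarith [mul_le_mul_of_nonneg_left hadd (sq_nonneg (a - b))]
  simp only [Real.negMulLog, Real.log_pow]
  push_cast
  nlinarith

variable {Ω : Type*} [MeasurableSpace Ω]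
variable {T : Type*} [Fintype T] [MeasurableSpace T] [MeasurableSingletonClass T]
variable {S : Type*} [MeasurableSpace S] [MeasurableSingletonClass S]

theorem real_map_singleton [DecidableEq S] (ν : Measure T) [IsFiniteMeasure ν] (φ : T → S)
    (s : S) : (ν.map φ).real {s} = ∑ t with φ t = s, ν.real {t} := by
  rw [map_measureReal_apply (measurable_of_finite φ) (measurableSet_singleton s),
    sum_measureReal_singleton]
  congr 1
  ext t
  simp

theorem real_singleton_le_real_map_singleton (ν : Measure Ω) [IsFiniteMeasure ν] {φ : Ω → S}
    (hφ : Measurable φ) (ω : Ω) : ν.real {ω} ≤ (ν.map φ).real {φ ω} := by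
  rw [map_measureReal_apply hφ (measurableSet_singleton _)]
  exact measureReal_mono fun s hs => congrArg φ hs

theorem real_singleton_eq_zero_of_map (ν : Measure Ω) [IsFiniteMeasure ν] {φ : Ω → S}
    (hφ : Measurable φ) {ω : Ω} (h : (ν.map φ).real {φ ω} = 0) : ν.real {ω} = 0 :=
  le_antisymm (h ▸ real_singleton_le_real_map_singleton ν hφ ω) measureReal_nonneg

theorem sum_real_singleton_eq_one (ν : Measure T) [IsProbabilityMeasure ν] :
    ∑ t, ν.real {t} = 1 := by
  simp [sum_measureReal_singleton]

theorem entropy_nonneg {T : Type*} [Fintype T] [MeasurableSpace T] (ν : Measure T)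
    [IsProbabilityMeasure ν] : 0 ≤ entropy ν :=
  Finset.sum_nonneg fun _ _ => Real.negMulLog_nonneg measureReal_nonneg measureReal_le_one

theorem entropy_le_neg_sum_mul_log (ν : Measure T) [IsProbabilityMeasure ν] {q : T → ℝ}
    (hq : ∀ t, 0 ≤ q t) (hsum : ∑ t, q t ≤ 1) (hac : ∀ t, q t = 0 → ν.real {t} = 0) :
    entropy ν ≤ -∑ t, ν.real {t} * Real.log (q t) := by
  have hgibbs := Finset.sum_le_sum fun t (_ : t ∈ Finset.univ) =>
    negMulLog_le_neg_mul_log_add_sub measureReal_nonneg (hq t) (hac t)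
  rw [Finset.sum_add_distrib, Finset.sum_sub_distrib, Finset.sum_neg_distrib,
    sum_real_singleton_eq_one] at hgibbs
  unfold entropy
  linarith

theorem entropy_le_log_card (ν : Measure T) [IsProbabilityMeasure ν] :
    entropy ν ≤ Real.log (Fintype.card T) := by
  obtain ⟨t⟩ : Nonempty T := ν.nonempty_of_neZero
  have hcard : (0 : ℝ) < Fintype.card T := by exact_mod_cast Fintype.card_pos_iff.2 ⟨t⟩
  calc entropy ν ≤ -∑ t, ν.real {t} * Real.log (Fintype.card T : ℝ)⁻¹ :=
        entropy_le_neg_sum_mul_log ν (fun _ => by positivity) (by simp [hcard.ne'])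
          fun _ h => absurd h (by positivity)
    _ = _ := by rw [← Finset.sum_mul, sum_real_singleton_eq_one, Real.log_inv]; ring

theorem neg_log_le_entropy (ν : Measure T) [IsProbabilityMeasure ν] {c : ℝ}
    (hc : ∀ t, ν.real {t} ≤ c) : -Real.log c ≤ entropy ν := by
  calc -Real.log c = ∑ t, -(ν.real {t} * Real.log c) := by
        rw [Finset.sum_neg_distrib, ← Finset.sum_mul, sum_real_singleton_eq_one, one_mul]
    _ ≤ entropy ν := Finset.sum_le_sum fun t _ => by
        rcases (measureReal_nonneg (μ := ν) (s := {t})).eq_or_lt with h | h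
        · simp [← h]
        · rw [Real.negMulLog, neg_mul, neg_le_neg_iff]
          gcongr
          exact hc t

theorem entropy_map_eq_neg_sum_mul_log [Fintype S] (ν : Measure T) [IsFiniteMeasure ν]
    (φ : T → S) :
    entropy (ν.map φ) = -∑ t, ν.real {t} * Real.log ((ν.map φ).real {φ t}) := by
  classical
  rw [← Finset.sum_fiberwise _ φ, ← Finset.sum_neg_distrib]
  refine Finset.sum_congr rfl fun s _ => ?_
  have hfiber : ∑ t with φ t = s, ν.real {t} * Real.log ((ν.map φ).real {φ t}) =
      ∑ t with φ t = s, ν.real {t} * Real.log ((ν.map φ).real {s}) :=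
    Finset.sum_congr rfl fun t ht => by rw [(Finset.mem_filter.1 ht).2]
  rw [hfiber, ← Finset.sum_mul, ← real_map_singleton ν φ s, Real.negMulLog, neg_mul]

theorem entropy_map_le [Fintype S] (ν : Measure T) [IsFiniteMeasure ν] (φ : T → S) :
    entropy (ν.map φ) ≤ entropy ν := by
  rw [entropy_map_eq_neg_sum_mul_log, entropy, ← Finset.sum_neg_distrib]
  refine Finset.sum_le_sum fun t _ => ?_
  rcases (measureReal_nonneg (μ := ν) (s := {t})).eq_or_lt with h | h
  · simp [← h]
  · rw [Real.negMulLog, neg_mul, neg_le_neg_iff]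
    gcongr
    exact real_singleton_le_real_map_singleton ν (measurable_of_finite φ) t

theorem entropy_le_of_factors [Fintype S] (μ : Measure Ω) [IsProbabilityMeasure μ] {f : Ω → S}
    {g : Ω → T} (hg : Measurable g) (h : ∀ x y, g x = g y → f x = f y) :
    entropy (μ.map f) ≤ entropy (μ.map g) := by
  obtain ⟨ω⟩ : Nonempty Ω := μ.nonempty_of_neZero
  have : Nonempty S := ⟨f ω⟩
  obtain ⟨φ, rfl⟩ := (Function.factorsThrough_iff f).1 fun x y hxy => h x y hxy
  rw [← Measure.map_map (measurable_of_finite φ) hg]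
  exact entropy_map_le _ _

theorem entropy_eq_of_factors [Fintype S] (μ : Measure Ω) [IsProbabilityMeasure μ] {f : Ω → S}
    {g : Ω → T} (hf : Measurable f) (hg : Measurable g) (h : ∀ x y, g x = g y ↔ f x = f y) :
    entropy (μ.map f) = entropy (μ.map g) :=
  le_antisymm (entropy_le_of_factors μ hg fun x y => (h x y).1)
    (entropy_le_of_factors μ hf fun x y => (h x y).2)

section Submodular

variable {A B C : Type*} [Fintype A] [MeasurableSpace A] [MeasurableSingletonClass A]
  [Fintype B] [MeasurableSpace B] [MeasurableSingletonClass B]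
  [Fintype C] [MeasurableSpace C] [MeasurableSingletonClass C]

theorem sum_real_singleton_prodMk {C : Type*} [MeasurableSpace C] [MeasurableSingletonClass C]
    (ν : Measure (A × C)) [IsFiniteMeasure ν] (c : C) :
    ∑ a, ν.real {(a, c)} = (ν.map Prod.snd).real {c} := by
  rw [map_measureReal_apply measurable_snd (measurableSet_singleton c),
    ← Set.univ_prod, ← Finset.coe_univ, ← Finset.coe_singleton, ← Finset.coe_product,
    ← sum_measureReal_singleton, Finset.sum_product]
  simp only [Finset.sum_singleton]

theorem sum_mul_div_eq_one (α : Measure (A × C)) (β : Measure (B × C)) (γ : Measure C)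
    [IsFiniteMeasure α] [IsFiniteMeasure β] [IsProbabilityMeasure γ]
    (hα : α.map Prod.snd = γ) (hβ : β.map Prod.snd = γ) :
    ∑ t : A × B × C, α.real {(t.1, t.2.2)} * β.real {t.2} / γ.real {t.2.2} = 1 := by
  simp_rw [Fintype.sum_prod_type, ← Finset.sum_comm (s := (Finset.univ : Finset C)),
    ← Finset.sum_div, ← Finset.mul_sum, sum_real_singleton_prodMk, hβ]
  simp_rw [← Finset.sum_mul, sum_real_singleton_prodMk, hα, mul_self_div_self]
  exact sum_real_singleton_eq_one γ

theorem entropy_prod_submodular (ν : Measure (A × B × C)) [IsProbabilityMeasure ν] :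
    entropy ν + entropy (ν.map fun t => t.2.2) ≤
      entropy (ν.map fun t => (t.1, t.2.2)) + entropy (ν.map Prod.snd) := by
  set α := ν.map fun t => (t.1, t.2.2)
  set β := ν.map Prod.snd
  set γ := ν.map fun t => t.2.2
  have hprob {D : Type _} [MeasurableSpace D] (φ : A × B × C → D) :
      IsProbabilityMeasure (ν.map φ) :=
    Measure.isProbabilityMeasure_map (measurable_of_finite φ).aemeasurable
  have hα0 (t) (h : α.real {(t.1, t.2.2)} = 0) : ν.real {t} = 0 :=
    real_singleton_eq_zero_of_map ν (measurable_of_finite _) h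
  have hβ0 (t) (h : β.real {t.2} = 0) : ν.real {t} = 0 :=
    real_singleton_eq_zero_of_map ν (measurable_of_finite _) h
  have hγ0 (t) (h : γ.real {t.2.2} = 0) : ν.real {t} = 0 :=
    real_singleton_eq_zero_of_map ν (measurable_of_finite _) h
  -- Gibbs' inequality against the law under which `a` and `b` are independent given `c`.
  have hgibbs := entropy_le_neg_sum_mul_log ν
    (q := fun t => α.real {(t.1, t.2.2)} * β.real {t.2} / γ.real {t.2.2})
    (fun t => by positivity)
    (sum_mul_div_eq_one α β γ (Measure.map_map (by fun_prop) (by fun_prop))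
      (Measure.map_map (by fun_prop) (by fun_prop))).le
    fun t h => by
      rcases div_eq_zero_iff.1 h with h | h
      · exact (mul_eq_zero.1 h).elim (hα0 t) (hβ0 t)
      · exact hγ0 t h
  have hlog (t) : ν.real {t} *
        Real.log (α.real {(t.1, t.2.2)} * β.real {t.2} / γ.real {t.2.2}) =
      ν.real {t} * Real.log (α.real {(t.1, t.2.2)}) + ν.real {t} * Real.log (β.real {t.2}) -
        ν.real {t} * Real.log (γ.real {t.2.2}) := by
    by_cases h : ν.real {t} = 0
    · simp [h]
    · rw [Real.log_div (mul_ne_zero (mt (hα0 t) h) (mt (hβ0 t) h)) (mt (hγ0 t) h),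
        Real.log_mul (mt (hα0 t) h) (mt (hβ0 t) h)]
      ring
  simp_rw [hlog, Finset.sum_sub_distrib, Finset.sum_add_distrib] at hgibbs
  rw [entropy_map_eq_neg_sum_mul_log ν fun t => (t.1, t.2.2),
    entropy_map_eq_neg_sum_mul_log ν Prod.snd, entropy_map_eq_neg_sum_mul_log ν fun t => t.2.2]
  linarith

theorem entropy_submodular (μ : Measure Ω) [IsProbabilityMeasure μ] {f : Ω → A} {g : Ω → B}
    {k : Ω → C} (hf : Measurable f) (hg : Measurable g) (hk : Measurable k) :
    entropy (μ.map fun ω => (f ω, g ω, k ω)) + entropy (μ.map k) ≤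
      entropy (μ.map fun ω => (f ω, k ω)) + entropy (μ.map fun ω => (g ω, k ω)) := by
  have hfgk : Measurable fun ω => (f ω, g ω, k ω) := by fun_prop
  have := Measure.isProbabilityMeasure_map (μ := μ) hfgk.aemeasurable
  have hsub := entropy_prod_submodular (μ.map fun ω => (f ω, g ω, k ω))
  rwa [Measure.map_map (by fun_prop) hfgk, Measure.map_map (by fun_prop) hfgk,
    Measure.map_map (by fun_prop) hfgk] at hsub

end Submodular

section Mixture

variable {A B : Type*} [Fintype A] [MeasurableSpace A] [MeasurableSingletonClass A]
  [Fintype B] [MeasurableSpace B] [MeasurableSingletonClass B]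

theorem real_prod_map_singleton {A : Type*} [Finite A] [MeasurableSpace A]
    [MeasurableSingletonClass A] (α : Measure A) (β : Measure B) [IsProbabilityMeasure α]
    [IsProbabilityMeasure β] (φ : A → B → S) (s : S) :
    ((α.prod β).map fun z => φ z.1 z.2).real {s} =
      ∑ b, β.real {b} * (α.map fun a => φ a b).real {s} := by
  classical
  cases nonempty_fintype A
  simp_rw [real_map_singleton, Finset.sum_filter, Fintype.sum_prod_type, Finset.mul_sum]
  rw [Finset.sum_comm]
  refine Finset.sum_congr rfl fun b _ => Finset.sum_congr rfl fun a _ => ?_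
  rw [← Set.singleton_prod_singleton, measureReal_prod_prod]
  split_ifs <;> ring

theorem negMulLog_sum_of_subsingleton_support {ι : Type*} [Fintype ι] (p : ι → ℝ)
    (h : p.support.Subsingleton) :
    Real.negMulLog (∑ i, p i) = ∑ i, Real.negMulLog (p i) := by
  rcases h.eq_empty_or_singleton with h | ⟨i, hi⟩
  · simp [Function.support_eq_empty_iff.1 h]
  · have h0 (j) (hj : j ≠ i) : p j = 0 := Function.notMem_support.1 (hi ▸ hj)
    rw [Fintype.sum_eq_single i h0, Fintype.sum_eq_single i fun j hj => by simp [h0 j hj]]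

theorem entropy_mixture {A : Type*} [Finite A] [MeasurableSpace A]
    [MeasurableSingletonClass A] (α : Measure A) (β : Measure B) [IsProbabilityMeasure α]
    [IsProbabilityMeasure β] (φ : A → B → T) (hφ : ∀ a a' b b', φ a b = φ a' b' → b = b') :
    entropy ((α.prod β).map fun z => φ z.1 z.2) =
      ∑ b, β.real {b} * entropy (α.map fun a => φ a b) + entropy β := by
  classical
  cases nonempty_fintype A
  have hmem_range {b t} (h : (α.map fun a => φ a b).real {t} ≠ 0) : ∃ a, φ a b = t := by
    rw [real_map_singleton] at h
    obtain ⟨a, ha, -⟩ := Finset.exists_ne_zero_of_sum_ne_zero h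
    exact ⟨a, (Finset.mem_filter.1 ha).2⟩
  have hprob (b) : IsProbabilityMeasure (α.map fun a => φ a b) :=
    Measure.isProbabilityMeasure_map (measurable_of_finite _).aemeasurable
  have hsplit (t) : Real.negMulLog (((α.prod β).map fun z => φ z.1 z.2).real {t}) =
      ∑ b, ((α.map fun a => φ a b).real {t} * Real.negMulLog (β.real {b}) +
        β.real {b} * Real.negMulLog ((α.map fun a => φ a b).real {t})) := by
    rw [real_prod_map_singleton, negMulLog_sum_of_subsingleton_support]
    · simp_rw [Real.negMulLog_mul]
    · intro b hb b' hb'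
      obtain ⟨a, ha⟩ := hmem_range (right_ne_zero_of_mul hb)
      obtain ⟨a', ha'⟩ := hmem_range (right_ne_zero_of_mul hb')
      exact hφ a a' b b' (ha.trans ha'.symm)
  simp_rw [entropy, hsplit]
  rw [Finset.sum_comm, ← Finset.sum_add_distrib]
  refine Finset.sum_congr rfl fun b _ => ?_
  rw [Finset.sum_add_distrib, ← Finset.sum_mul, sum_real_singleton_eq_one, Finset.mul_sum]
  ring

theorem mutualInfo_eq_sum (α : Measure A) (β : Measure B) [IsProbabilityMeasure α]
    [IsProbabilityMeasure β] (φ : A → B → T) (hφ : ∀ a a' b b', φ a b = φ a' b' → b = b') :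
    entropy α + entropy ((α.prod β).map fun z => φ z.1 z.2) -
        entropy ((α.prod β).map fun z => (z.1, φ z.1 z.2)) =
      ∑ b, β.real {b} * entropy (α.map fun a => φ a b) := by
  have hgraph (b) : entropy (α.map fun a => (a, φ a b)) = entropy α := by
    have h := entropy_eq_of_factors α (f := fun a => (a, φ a b)) (g := id)
      (measurable_of_finite _) measurable_id (fun x y => by simp +contextual)
    rwa [Measure.map_id] at h
  rw [entropy_mixture α β φ hφ, entropy_mixture α β (fun a b => (a, φ a b))
    fun a a' b b' h => hφ a a' b b' (Prod.ext_iff.1 h).2]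
  simp_rw [hgraph]
  rw [← Finset.sum_mul, sum_real_singleton_eq_one]
  ring

end Mixture

end Entropy

section RandomErasure

/-- The mean of `g R` over a random subset `R` of `S` from which each element is erased
independently with probability `ε`, as a linear functional of `g`. -/
def erasureMean {ι : Type*} [DecidableEq ι] (ε : ℝ) (S : Finset ι) : (Finset ι → ℝ) →ₗ[ℝ] ℝ :=
  ∑ R ∈ S.powerset, ((1 - ε) ^ R.card * ε ^ (S \ R).card) • LinearMap.proj R

variable {ι : Type*} [DecidableEq ι] {ε : ℝ} {S : Finset ι}

theorem erasureMean_apply (ε : ℝ) (S : Finset ι) (g : Finset ι → ℝ) :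
    erasureMean ε S g = ∑ R ∈ S.powerset, (1 - ε) ^ R.card * ε ^ (S \ R).card * g R := by
  simp [erasureMean, LinearMap.sum_apply]

@[simp]
theorem erasureMean_empty (ε : ℝ) (g : Finset ι → ℝ) : erasureMean ε ∅ g = g ∅ := by
  simp [erasureMean]

theorem erasureMean_insert (ε : ℝ) {a : ι} (ha : a ∉ S) (g : Finset ι → ℝ) :
    erasureMean ε (insert a S) g =
      ε * erasureMean ε S g + (1 - ε) * erasureMean ε S (fun R => g (insert a R)) := by
  simp only [erasureMean_apply]
  rw [Finset.sum_powerset_insert ha, Finset.mul_sum, Finset.mul_sum]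
  congr 1 <;> refine Finset.sum_congr rfl fun R hR => ?_ <;>
    have haR : a ∉ R := fun h => ha (Finset.mem_powerset.1 hR h)
  · rw [Finset.insert_sdiff_of_notMem _ haR, Finset.card_insert_of_notMem (by simp [ha])]
    ring
  · rw [Finset.card_insert_of_notMem haR, Finset.insert_sdiff_insert,
      Finset.sdiff_insert_of_notMem ha]
    ring

theorem erasureMean_singleton (ε : ℝ) (a : ι) (g : Finset ι → ℝ) :
    erasureMean ε {a} g = ε * g ∅ + (1 - ε) * g {a} := by
  simpa using erasureMean_insert ε (Finset.notMem_empty a) g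

theorem erasureMean_congr (ε : ℝ) {g g' : Finset ι → ℝ} (h : ∀ R ⊆ S, g R = g' R) :
    erasureMean ε S g = erasureMean ε S g' := by
  simp only [erasureMean_apply]
  exact Finset.sum_congr rfl fun R hR => by rw [h R (Finset.mem_powerset.1 hR)]

theorem erasureMean_mono (hε : ε ∈ Set.Icc (0 : ℝ) 1) {g g' : Finset ι → ℝ}
    (h : ∀ R ⊆ S, g R ≤ g' R) : erasureMean ε S g ≤ erasureMean ε S g' := by
  have h0 := hε.1
  have h1 : 0 ≤ 1 - ε := sub_nonneg.2 hε.2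
  simp only [erasureMean_apply]
  exact Finset.sum_le_sum fun R hR =>
    mul_le_mul_of_nonneg_left (h R (Finset.mem_powerset.1 hR)) (by positivity)

theorem erasureMean_union_inter (ε : ℝ) {V : Finset ι} (hV : Disjoint S V) (g : Finset ι → ℝ) :
    erasureMean ε (V ∪ S) (fun R => g (R ∩ S)) = erasureMean ε S g := by
  induction V using Finset.induction_on with
  | empty =>
    rw [Finset.empty_union]
    exact erasureMean_congr ε fun R hR => by rw [Finset.inter_eq_left.2 hR]
  | insert a V ha ih =>
    rw [Finset.disjoint_insert_right] at hV
    rw [Finset.insert_union, erasureMean_insert ε (by simp [ha, hV.1]), ih hV.2]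
    simp only [Finset.insert_inter_of_notMem hV.1]
    rw [ih hV.2]
    ring

theorem erasureMean_inter (ε : ℝ) {U : Finset ι} (h : S ⊆ U) (g : Finset ι → ℝ) :
    erasureMean ε U (fun R => g (R ∩ S)) = erasureMean ε S g := by
  simpa only [Finset.sdiff_union_of_subset h] using
    erasureMean_union_inter ε (Finset.disjoint_sdiff (s := S) (t := U)) g

theorem erasureMean_const (ε : ℝ) (S : Finset ι) (c : ℝ) : erasureMean ε S (fun _ => c) = c := by
  rw [erasureMean_inter ε (Finset.empty_subset S) (fun _ => c), erasureMean_empty]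

theorem erasureMean_map (ε : ℝ) {κ : Type*} [DecidableEq κ] (f : κ ↪ ι) (T : Finset κ)
    (g : Finset ι → ℝ) :
    erasureMean ε (T.map f) g = erasureMean ε T (fun R => g (R.map f)) := by
  induction T using Finset.induction_on generalizing g with
  | empty => simp
  | insert a T ha ih =>
    rw [Finset.map_insert, erasureMean_insert ε (by simpa using ha), erasureMean_insert ε ha, ih,
      ih]
    simp only [Finset.map_insert]

theorem erasureMean_notMem (ε : ℝ) {i : ι} (hi : i ∈ S) :
    erasureMean ε S (fun R => if i ∈ R then 0 else 1) = ε := by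
  have h := erasureMean_inter ε (Finset.singleton_subset_iff.2 hi)
    (fun R => if i ∈ R then 0 else 1)
  simp only [Finset.mem_inter, Finset.mem_singleton, and_true] at h
  rw [h, erasureMean_singleton]
  simp

theorem erasureMean_notMem_notMem (ε : ℝ) {i j : ι} (hi : i ∈ S) (hj : j ∈ S) (hij : i ≠ j) :
    erasureMean ε S (fun R => if i ∈ R ∨ j ∈ R then 0 else 1) = ε ^ 2 := by
  have h := erasureMean_inter ε (S := {i, j}) (U := S)
    (by simp [Finset.insert_subset_iff, hi, hj]) (fun R => if i ∈ R ∨ j ∈ R then 0 else 1)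
  simp only [Finset.mem_inter, Finset.mem_insert, Finset.mem_singleton, or_true, true_or,
    and_true] at h
  rw [h, erasureMean_insert ε (by simpa using hij), erasureMean_singleton, erasureMean_singleton]
  simp [hij]
  ring

end RandomErasure

section Polymatroid

/-- Normalized, monotone and submodular set functions, such as the joint entropies of the
subfamilies of a family of random variables. -/
structure IsPolymatroid {ι : Type*} [DecidableEq ι] (h : Finset ι → ℝ) : Prop where
  empty : h ∅ = 0
  mono : Monotone h
  submodular : ∀ S T, h (S ∪ T) + h (S ∩ T) ≤ h S + h T

/-- Polymatroids on `ℤ` that are invariant under translation, such as the entropies of the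
blocks of a stationary process. -/
structure IsStationaryPolymatroid (h : Finset ℤ → ℝ) : Prop extends IsPolymatroid h where
  shift : ∀ (c : ℤ) S, h (S.map (addRightEmbedding c)) = h S

/-- The growth rate of `h` along the intervals `{1, …, n}`. -/
def blockRate (h : Finset ℤ → ℝ) : ℝ :=
  limUnder atTop fun n : ℕ => h (Finset.Icc 1 n) / n

namespace IsPolymatroid

variable {ι : Type*} [DecidableEq ι] {h : Finset ι → ℝ} {ε : ℝ}

theorem nonneg (hh : IsPolymatroid h) (S : Finset ι) : 0 ≤ h S :=
  hh.empty ▸ hh.mono (Finset.empty_subset S)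

theorem insert_sub_le_insert_sub (hh : IsPolymatroid h) (i : ι) {R R' : Finset ι} (hR : R ⊆ R') :
    h (insert i R') - h R' ≤ h (insert i R) - h R := by
  by_cases hi : i ∈ R'
  · rw [Finset.insert_eq_of_mem hi, sub_self, sub_nonneg]
    exact hh.mono (Finset.subset_insert i R)
  · have hs := hh.submodular (insert i R) R'
    rw [Finset.insert_union, Finset.union_eq_right.2 hR, Finset.insert_inter_of_notMem hi,
      Finset.inter_eq_left.2 hR] at hs
    linarith

theorem union_sub_le_sum (hh : IsPolymatroid h) (R V : Finset ι) :
    h (V ∪ R) - h R ≤ ∑ i ∈ V, (h (insert i R) - h R) := by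
  induction V using Finset.induction_on with
  | empty => simp
  | insert a V ha ih =>
    rw [Finset.sum_insert ha, Finset.insert_union]
    linarith [hh.insert_sub_le_insert_sub a (Finset.subset_union_right : R ⊆ V ∪ R)]

protected theorem erasureMean (hh : IsPolymatroid h) (hε : ε ∈ Set.Icc (0 : ℝ) 1) :
    IsPolymatroid fun S => erasureMean ε S h where
  empty := by rw [erasureMean_empty, hh.empty]
  mono S T hST := by
    simp only [← erasureMean_inter ε hST h]
    exact erasureMean_mono hε fun R _ => hh.mono Finset.inter_subset_left
  submodular S T := by
    rw [← erasureMean_inter ε (Finset.inter_subset_union : S ∩ T ⊆ S ∪ T) h,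
      ← erasureMean_inter ε (Finset.subset_union_left : S ⊆ S ∪ T) h,
      ← erasureMean_inter ε (Finset.subset_union_right : T ⊆ S ∪ T) h, ← map_add, ← map_add]
    refine erasureMean_mono hε fun R hR => ?_
    have hs := hh.submodular (R ∩ S) (R ∩ T)
    rwa [← Finset.inter_union_distrib_left, Finset.inter_eq_left.2 hR,
      ← Finset.inter_inter_distrib_left] at hs

end IsPolymatroid

namespace IsStationaryPolymatroid

variable {h : Finset ℤ → ℝ} {ε : ℝ}

protected theorem erasureMean (hh : IsStationaryPolymatroid h) (hε : ε ∈ Set.Icc (0 : ℝ) 1) :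
    IsStationaryPolymatroid fun S => erasureMean ε S h where
  toIsPolymatroid := hh.toIsPolymatroid.erasureMean hε
  shift c S := by
    rw [erasureMean_map]
    exact erasureMean_congr ε fun R _ => hh.shift c R

theorem Icc_add (hh : IsStationaryPolymatroid h) (a b c : ℤ) :
    h (Finset.Icc (a + c) (b + c)) = h (Finset.Icc a b) := by
  rw [← Finset.map_add_right_Icc, hh.shift]

theorem singleton_eq (hh : IsStationaryPolymatroid h) (i : ℤ) : h {i} = h {1} := by
  simpa using hh.shift (i - 1) {1}

theorem subadditive (hh : IsStationaryPolymatroid h) :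
    Subadditive fun n : ℕ => h (Finset.Icc 1 n) := by
  intro m n
  have hs := hh.submodular (Finset.Icc 1 m) (Finset.Icc (1 + m) (n + m))
  have hunion : (Finset.Icc 1 m ∪ Finset.Icc (1 + m) (n + m) : Finset ℤ) =
      Finset.Icc 1 ((m + n : ℕ) : ℤ) := by
    ext x
    simp only [Finset.mem_union, Finset.mem_Icc]
    omega
  rw [hh.Icc_add, hunion] at hs
  linarith [hh.nonneg (Finset.Icc 1 m ∩ Finset.Icc (1 + m) (n + m))]

theorem bddBelow_range (hh : IsStationaryPolymatroid h) :
    BddBelow (Set.range fun n : ℕ => h (Finset.Icc 1 n) / n) :=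
  ⟨0, Set.forall_mem_range.2 fun n => div_nonneg (hh.nonneg _) n.cast_nonneg⟩

theorem tendsto_blockRate (hh : IsStationaryPolymatroid h) :
    Tendsto (fun n : ℕ => h (Finset.Icc 1 n) / n) atTop (𝓝 (blockRate h)) :=
  tendsto_nhds_limUnder ⟨_, hh.subadditive.tendsto_lim hh.bddBelow_range⟩

theorem mul_blockRate_le (hh : IsStationaryPolymatroid h) (n : ℕ) :
    n * blockRate h ≤ h (Finset.Icc 1 n) := by
  rcases n.eq_zero_or_pos with rfl | hn
  · simpa using hh.nonneg _
  · have hlim : blockRate h = hh.subadditive.lim :=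
      (hh.subadditive.tendsto_lim hh.bddBelow_range).limUnder_eq
    rw [mul_comm, ← le_div_iff₀ (by positivity), hlim]
    exact hh.subadditive.lim_le_div hh.bddBelow_range hn.ne'

theorem le_blockRate (hh : IsStationaryPolymatroid h) {a b : ℝ}
    (hlb : ∀ n : ℕ, n * a - b ≤ h (Finset.Icc 1 n)) : a ≤ blockRate h := by
  have hlim : Tendsto (fun n : ℕ => a - b / n) atTop (𝓝 a) := by
    simpa using tendsto_const_nhds.sub (tendsto_const_div_atTop_nhds_zero_nat b)
  refine le_of_tendsto_of_tendsto hlim hh.tendsto_blockRate ?_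
  filter_upwards [eventually_gt_atTop 0] with n hn
  have : (0 : ℝ) < n := Nat.cast_pos.2 hn
  calc a - b / n = (n * a - b) / n := by field_simp
    _ ≤ _ := by gcongr; exact hlb n

theorem Icc_add_le (hh : IsStationaryPolymatroid h) (k m : ℕ) :
    h (Finset.Icc 1 ((k + m : ℕ) : ℤ)) ≤ h (Finset.Icc 1 k) +
      m * (h (Finset.Icc 1 ((k + 1 : ℕ) : ℤ)) - h (Finset.Icc 1 k)) := by
  induction m with
  | zero => simp
  | succ m ih =>
    have hdim := hh.insert_sub_le_insert_sub (k + m + 1 : ℤ)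
      (R := Finset.Icc (1 + m) (k + m)) (R' := Finset.Icc 1 (k + m))
      (Finset.Icc_subset_Icc_left (by omega))
    have hleft : (insert (k + m + 1 : ℤ) (Finset.Icc 1 (k + m)) : Finset ℤ) =
        Finset.Icc 1 ((k + (m + 1) : ℕ) : ℤ) := by
      ext x
      simp only [Finset.mem_insert, Finset.mem_Icc]
      omega
    have hright : (insert (k + m + 1 : ℤ) (Finset.Icc (1 + m) (k + m)) : Finset ℤ) =
        Finset.Icc (1 + (m : ℤ)) ((k + 1 : ℕ) + (m : ℤ)) := by
      ext x
      simp only [Finset.mem_insert, Finset.mem_Icc]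
      omega
    rw [hleft, hright, hh.Icc_add, hh.Icc_add] at hdim
    push_cast at *
    linarith

theorem blockRate_le_increment (hh : IsStationaryPolymatroid h) (k : ℕ) :
    blockRate h ≤ h (Finset.Icc 1 ((k + 1 : ℕ) : ℤ)) - h (Finset.Icc 1 k) := by
  by_contra! hlt
  obtain ⟨m, hm⟩ := Archimedean.arch (h (Finset.Icc 1 k) - k * blockRate h + 1) (sub_pos.2 hlt)
  have hle := (hh.mul_blockRate_le (k + m)).trans (hh.Icc_add_le k m)
  rw [nsmul_eq_mul] at hm
  push_cast at *
  linarith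

theorem blockRate_le_singleton (hh : IsStationaryPolymatroid h) : blockRate h ≤ h {1} := by
  simpa [hh.empty] using hh.blockRate_le_increment 0

theorem erasureMean_triple_sub_pair (hh : IsStationaryPolymatroid h) :
    erasureMean ε {1, 2, 3} h - erasureMean ε {1, 2} h =
      (1 - ε) * ((1 - ε) ^ 2 * (h {1, 2, 3} - h {1, 2}) +
        ε * (1 - ε) * ((h {1, 2} - h {1}) + (h {1, 3} - h {1})) + ε ^ 2 * h {1}) := by
  have h23 : h {2, 3} = h {1, 2} := by simpa using hh.shift 1 {1, 2}
  rw [erasureMean_insert ε (a := 1) (S := {2, 3}) (by decide),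
    erasureMean_insert ε (a := 1) (S := {2}) (by decide)]
  simp only [erasureMean_insert ε (show (2 : ℤ) ∉ ({3} : Finset ℤ) by decide),
    erasureMean_singleton, insert_empty_eq, hh.empty, hh.singleton_eq 2, hh.singleton_eq 3, h23]
  ring

theorem insert_sub_le (hh : IsStationaryPolymatroid h) (R : Finset ℤ) (i : ℤ) :
    h (insert i R) - h R ≤ (h {1, 2, 3} - h {1, 3}) +
      h {1} * ((if i - 1 ∈ R then 0 else 1) + (if i + 1 ∈ R then 0 else 1)) := by
  have hinner : 0 ≤ h {1, 2, 3} - h {1, 3} := sub_nonneg.2 (hh.mono (by decide))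
  have hone : h (insert i R) - h R ≤ h {1} := by
    simpa [hh.empty, hh.singleton_eq i] using
      hh.insert_sub_le_insert_sub i (Finset.empty_subset R)
  have hnonneg := hh.nonneg {1}
  by_cases hleft : i - 1 ∈ R
  · by_cases hright : i + 1 ∈ R
    · have htriple : h (insert i {i - 1, i + 1}) = h {1, 2, 3} := by
        rw [Finset.insert_comm, ← hh.shift (i - 2) {1, 2, 3}]
        congr 1
        simp only [Finset.map_insert, Finset.map_singleton, addRightEmbedding_apply]
        ring_nf
      have hpair : h {i - 1, i + 1} = h {1, 3} := by
        rw [← hh.shift (i - 2) {1, 3}]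
        congr 1
        simp only [Finset.map_insert, Finset.map_singleton, addRightEmbedding_apply]
        ring_nf
      have hdim := hh.insert_sub_le_insert_sub i (R := {i - 1, i + 1}) (R' := R)
        (by simp [Finset.insert_subset_iff, hleft, hright])
      simp only [hleft, hright, if_true]
      linarith
    · simp only [hleft, hright, if_true, if_false]
      linarith
  · simp only [hleft, if_false]
    split_ifs <;> linarith

theorem Icc_le_add_sum (hh : IsStationaryPolymatroid h) (n : ℕ) (R : Finset ℤ) :
    h (Finset.Icc 1 n) ≤ h R + ∑ i ∈ Finset.Icc 1 (n : ℤ),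
      ((h {1, 2, 3} - h {1, 3}) * (if i ∈ R then 0 else 1) +
        (h {1} * (if i ∈ R ∨ i - 1 ∈ R then 0 else 1) +
          h {1} * (if i ∈ R ∨ i + 1 ∈ R then 0 else 1))) := by
  have hunion := hh.union_sub_le_sum R (Finset.Icc 1 n)
  have hmono := hh.mono (Finset.subset_union_left : Finset.Icc 1 (n : ℤ) ⊆ Finset.Icc 1 n ∪ R)
  have hterm (i : ℤ) : h (insert i R) - h R ≤
      (h {1, 2, 3} - h {1, 3}) * (if i ∈ R then 0 else 1) +
        (h {1} * (if i ∈ R ∨ i - 1 ∈ R then 0 else 1) +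
          h {1} * (if i ∈ R ∨ i + 1 ∈ R then 0 else 1)) := by
    by_cases hi : i ∈ R
    · simp [hi]
    · simp only [hi, if_false, false_or]
      linarith [hh.insert_sub_le R i]
  linarith [Finset.sum_le_sum fun i (_ : i ∈ Finset.Icc 1 (n : ℤ)) => hterm i]

theorem Icc_le_erasureMean (hh : IsStationaryPolymatroid h) (hε : ε ∈ Set.Icc (0 : ℝ) 1)
    (n : ℕ) :
    h (Finset.Icc 1 n) ≤ erasureMean ε (Finset.Icc 1 ((n + 2 : ℕ) : ℤ)) h +
      n * (ε * (h {1, 2, 3} - h {1, 3}) + 2 * h {1} * ε ^ 2) := by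
  set U := Finset.Icc (0 : ℤ) (n + 1) with hU
  let χ (i : ℤ) (R : Finset ℤ) : ℝ := if i ∈ R then 0 else 1
  let ψ (i j : ℤ) (R : Finset ℤ) : ℝ := if i ∈ R ∨ j ∈ R then 0 else 1
  let bound : Finset ℤ → ℝ := h + ∑ i ∈ Finset.Icc 1 (n : ℤ),
    ((h {1, 2, 3} - h {1, 3}) • χ i + (h {1} • ψ i (i - 1) + h {1} • ψ i (i + 1)))
  -- Erasing also the positions `0` and `n + 1` avoids boundary terms.
  have hmean : erasureMean ε U (fun _ => h (Finset.Icc 1 n)) ≤ erasureMean ε U bound :=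
    erasureMean_mono hε fun R _ => by simpa [bound, χ, ψ] using hh.Icc_le_add_sum n R
  have hterm (i) (hi : i ∈ Finset.Icc 1 (n : ℤ)) :
      (h {1, 2, 3} - h {1, 3}) • erasureMean ε U (χ i) +
          (h {1} • erasureMean ε U (ψ i (i - 1)) + h {1} • erasureMean ε U (ψ i (i + 1))) =
        ε * (h {1, 2, 3} - h {1, 3}) + 2 * h {1} * ε ^ 2 := by
    have hmem (j : ℤ) (hj : j ∈ Finset.Icc (i - 1) (i + 1)) : j ∈ U := by
      rw [hU]
      rw [Finset.mem_Icc] at *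
      omega
    rw [erasureMean_notMem ε (hmem i (by simp)),
      erasureMean_notMem_notMem ε (hmem i (by simp)) (hmem (i - 1) (by simp; omega)) (by omega),
      erasureMean_notMem_notMem ε (hmem i (by simp)) (hmem (i + 1) (by simp; omega)) (by simp)]
    simp only [smul_eq_mul]
    ring
  have hshift : erasureMean ε U h = erasureMean ε (Finset.Icc 1 ((n + 2 : ℕ) : ℤ)) h := by
    rw [← (hh.erasureMean hε).Icc_add 0 (n + 1) 1]
    push_cast
    ring_nf
  rw [erasureMean_const, map_add, map_sum] at hmean
  simp only [map_add, map_smul] at hmean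
  rw [Finset.sum_congr rfl hterm, hshift] at hmean
  simpa [mul_add] using hmean

theorem le_blockRate_erasureMean (hh : IsStationaryPolymatroid h) (hε : ε ∈ Set.Icc (0 : ℝ) 1) :
    blockRate h - (ε * (h {1, 2, 3} - h {1, 3}) + 2 * h {1} * ε ^ 2) ≤
      blockRate fun S => erasureMean ε S h := by
  refine (hh.erasureMean hε).le_blockRate
    (b := erasureMean ε (Finset.Icc 1 ((2 : ℕ) : ℤ)) h) fun n => ?_
  have hrate := hh.mul_blockRate_le n
  have hmean := hh.Icc_le_erasureMean hε n
  have hsub := (hh.erasureMean hε).subadditive n 2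
  linarith

end IsStationaryPolymatroid

end Polymatroid

section BlockEntropy

/-- The entropy of the letters of a process with law `P` at the times in `S`. -/
def blockEntropy {A : Type*} [Fintype A] [MeasurableSpace A] (P : Measure (ℤ → A))
    (S : Finset ℤ) : ℝ :=
  entropy (P.map S.restrict)

theorem restrict_eq_iff {A : Type*} {S : Finset ℤ} {x y : ℤ → A} :
    S.restrict x = S.restrict y ↔ ∀ i ∈ S, x i = y i := by
  simp [funext_iff]

variable {A : Type*} [Fintype A] [MeasurableSpace A] [MeasurableSingletonClass A]
  {P : Measure (ℤ → A)} [IsProbabilityMeasure P]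

theorem blockEntropy_eq_entropy_map (P : Measure (ℤ → A)) [IsProbabilityMeasure P] {T : Type*}
    [Fintype T] [MeasurableSpace T] [MeasurableSingletonClass T] {S : Finset ℤ}
    {f : (ℤ → A) → T} (hf : Measurable f) (h : ∀ x y, f x = f y ↔ ∀ i ∈ S, x i = y i) :
    blockEntropy P S = entropy (P.map f) :=
  entropy_eq_of_factors P (Finset.measurable_restrict S) hf fun x y =>
    (h x y).trans restrict_eq_iff.symm

theorem blockEntropy_singleton_le_log_card (P : Measure (ℤ → A)) [IsProbabilityMeasure P]
    (i : ℤ) : blockEntropy P {i} ≤ Real.log (Fintype.card A) := by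
  have heval : Measurable fun x : ℤ → A => x i := measurable_pi_apply i
  have := Measure.isProbabilityMeasure_map (μ := P) heval.aemeasurable
  rw [blockEntropy_eq_entropy_map P heval fun x y => by simp]
  exact entropy_le_log_card _

theorem isPolymatroid_blockEntropy (P : Measure (ℤ → A)) [IsProbabilityMeasure P] :
    IsPolymatroid (blockEntropy P) where
  empty := by
    have := Measure.isProbabilityMeasure_map (μ := P)
      (Finset.measurable_restrict (X := fun _ : ℤ => A) ∅).aemeasurable
    refine le_antisymm ?_ (entropy_nonneg _)
    simpa [blockEntropy] using entropy_le_log_card (P.map (∅ : Finset ℤ).restrict)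
  mono S T hST := entropy_le_of_factors P (Finset.measurable_restrict T) fun x y h => by
    rw [restrict_eq_iff] at h ⊢
    exact fun i hi => h i (hST hi)
  submodular S T := by
    have hS := Finset.measurable_restrict (X := fun _ : ℤ => A) S
    have hT := Finset.measurable_restrict (X := fun _ : ℤ => A) T
    have hI := Finset.measurable_restrict (X := fun _ : ℤ => A) (S ∩ T)
    have h := entropy_submodular P hS hT hI
    rw [← blockEntropy_eq_entropy_map P (S := S ∪ T) (hS.prodMk (hT.prodMk hI)),
      ← blockEntropy_eq_entropy_map P (S := S) (hS.prodMk hI),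
      ← blockEntropy_eq_entropy_map P (S := T) (hT.prodMk hI)] at h
    · exact h
    all_goals
      intro x y
      simp only [Prod.mk.injEq, restrict_eq_iff]
      grind

theorem blockEntropy_map_add_one (hP : IsStationary P) (S : Finset ℤ) :
    blockEntropy P (S.map (addRightEmbedding 1)) = blockEntropy P S := by
  have hshift : Measurable fun x : ℤ → A => S.restrict fun k => x (k + 1) :=
    (Finset.measurable_restrict S).comp hP.measurable
  rw [blockEntropy_eq_entropy_map P hshift fun x y => by rw [restrict_eq_iff]; simp]
  conv_rhs => rw [blockEntropy, ← hP.map_eq]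
  rw [Measure.map_map (Finset.measurable_restrict S) hP.measurable]
  rfl

theorem IsStationary.isStationaryPolymatroid_blockEntropy (hP : IsStationary P) :
    IsStationaryPolymatroid (blockEntropy P) where
  toIsPolymatroid := isPolymatroid_blockEntropy P
  shift c S := by
    have hadd (a b : ℤ) : (S.map (addRightEmbedding a)).map (addRightEmbedding b) =
        S.map (addRightEmbedding (a + b)) := by
      rw [Finset.map_map]
      congr 1
      ext x
      simp [add_assoc]
    induction c using Int.induction_on with
    | zero =>
      congr 1
      ext x
      simp
    | succ i ih => rw [← hadd, blockEntropy_map_add_one hP, ih]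
    | pred i ih =>
      rw [← blockEntropy_map_add_one hP, hadd]
      simpa using ih

end BlockEntropy

section BlockInfo

variable {K : ℕ}

instance (ε : unitInterval) : IsProbabilityMeasure (erasureLaw ε) := by
  unfold erasureLaw
  infer_instance

/-- The embedding `k ↦ k + 1` that sends `{0, …, n - 1}` to the times `{1, …, n}`. -/
def timeEmbedding (n : ℕ) : Fin n ↪ ℤ :=
  ⟨fun k => (k : ℕ) + 1, fun a b h => by simpa [Fin.ext_iff] using h⟩

/-- The letters `x_1, …, x_n` of a two-sided sequence. -/
def block {A : Type*} (n : ℕ) (x : ℤ → A) : Fin n → A :=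
  fun k => x (timeEmbedding n k)

theorem measurable_block {A : Type*} [MeasurableSpace A] (n : ℕ) :
    Measurable (block n : (ℤ → A) → Fin n → A) :=
  measurable_pi_lambda _ fun _ => measurable_pi_apply _

theorem timeEmbedding_apply (n : ℕ) (k : Fin n) : timeEmbedding n k = (k : ℕ) + 1 := rfl

theorem map_timeEmbedding_univ (n : ℕ) :
    Finset.univ.map (timeEmbedding n) = Finset.Icc 1 (n : ℤ) := by
  ext x
  simp only [timeEmbedding_apply, Finset.mem_map, Finset.mem_univ, true_and, Finset.mem_Icc]
  constructor
  · rintro ⟨k, rfl⟩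
    omega
  · rintro ⟨h1, h2⟩
    exact ⟨⟨(x - 1).toNat, by omega⟩, by simp only; omega⟩

theorem bernoulliMeasure_real_singleton (ε : unitInterval) (a : Fin 2) :
    (ProbabilityTheory.bernoulliMeasure (0 : Fin 2) 1 ε).real {a} =
      if a = 1 then 1 - (ε : ℝ) else ε := by
  fin_cases a <;> simp

theorem erasureLaw_map_block_real_singleton (ε : unitInterval) (n : ℕ) (e : Fin n → Fin 2) :
    ((erasureLaw ε).map (block n)).real {e} =
      (1 - (ε : ℝ)) ^ (Finset.univ.filter (e · = 1)).card *
        (ε : ℝ) ^ (Finset.univ \ Finset.univ.filter (e · = 1)).card := by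
  have hmap : (erasureLaw ε).map (block n) =
      Measure.infinitePi fun _ => ProbabilityTheory.bernoulliMeasure (0 : Fin 2) 1 ε :=
    Measure.map_infinitePi_infinitePi_of_inj (timeEmbedding n).injective
  rw [hmap, measureReal_def, Measure.infinitePi_singleton_of_fintype, ENNReal.toReal_prod]
  simp_rw [← measureReal_def, bernoulliMeasure_real_singleton]
  rw [Finset.prod_ite, Finset.prod_const, Finset.prod_const, Finset.filter_not]

theorem eq_of_output_eq {x x' : Input K} {e e' : Fin 2} (h : output x e = output x' e') :
    e = e' := by
  have hx := x.2
  have hx' := x'.2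
  unfold output at h
  fin_cases e <;> fin_cases e' <;> simp_all

theorem output_eq_output_iff {x x' : Input K} {e : Fin 2} :
    output x e = output x' e ↔ (e = 1 → x = x') := by
  unfold output
  fin_cases e <;> simp [Subtype.ext_iff]

theorem blockInfo_eq_sum (P : Measure (ℤ → Input K)) [IsProbabilityMeasure P] (ε : unitInterval)
    (n : ℕ) :
    blockInfo P ε n = ∑ e, ((erasureLaw ε).map (block n)).real {e} *
      entropy ((P.map (block n)).map fun x k => output (x k) (e k)) := by
  have hX : Measurable (block n : (ℤ → Input K) → _) := measurable_block n
  have hE : Measurable (block n : (ℤ → Fin 2) → _) := measurable_block n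
  have := Measure.isProbabilityMeasure_map (μ := P) hX.aemeasurable
  have := Measure.isProbabilityMeasure_map (μ := erasureLaw ε) hE.aemeasurable
  have hprod : (P.map (block n)).prod ((erasureLaw ε).map (block n)) =
      (jointLaw P ε).map (Prod.map (block n) (block n)) := Measure.map_prod_map _ _ hX hE
  have hinput : (jointLaw P ε).map (inputBlock n) = P.map (block n) := by
    rw [show inputBlock n = block n ∘ Prod.fst (β := ℤ → Fin 2) from rfl,
      ← Measure.map_map hX measurable_fst, jointLaw, Measure.map_fst_prod]
    simp
  rw [← mutualInfo_eq_sum _ _ (fun (x : Fin n → Input K) (e : Fin n → Fin 2) k =>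
    output (x k) (e k)) fun a a' b b' h => funext fun k => eq_of_output_eq (congrFun h k),
    hprod, Measure.map_map (measurable_of_finite _) (hX.prodMap hE),
    Measure.map_map (measurable_of_finite _) (hX.prodMap hE), ← hinput]
  rfl

theorem entropy_map_output (P : Measure (ℤ → Input K)) [IsProbabilityMeasure P] {n : ℕ}
    (e : Fin n → Fin 2) :
    entropy ((P.map (block n)).map fun x k => output (x k) (e k)) =
      blockEntropy P ((Finset.univ.filter (e · = 1)).map (timeEmbedding n)) := by
  rw [Measure.map_map (measurable_of_finite _) (measurable_block n)]
  refine (blockEntropy_eq_entropy_map P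
    ((measurable_of_finite _).comp (measurable_block n)) fun x y => ?_).symm
  simp [funext_iff, output_eq_output_iff, block]

theorem blockInfo_eq_erasureMean (P : Measure (ℤ → Input K)) [IsProbabilityMeasure P]
    (ε : unitInterval) (n : ℕ) :
    blockInfo P ε n = erasureMean (ε : ℝ) (Finset.Icc 1 (n : ℤ)) (blockEntropy P) := by
  rw [blockInfo_eq_sum, ← map_timeEmbedding_univ, erasureMean_map, erasureMean_apply]
  refine Finset.sum_nbij' (fun e => Finset.univ.filter (e · = 1))
    (fun R k => if k ∈ R then 1 else 0) (by simp) (by simp) ?_ ?_ ?_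
  · intro e _
    ext k
    rcases (by omega : e k = 0 ∨ e k = 1) with h | h <;> simp [h]
  · intro R _
    ext k
    simp
  · intro e _
    rw [erasureLaw_map_block_real_singleton, entropy_map_output]

end BlockInfo

section InfoRate

variable {K : ℕ} {S : Set (List (Input K))} {P : Measure (ℤ → Input K)}

theorem card_input (K : ℕ) : Fintype.card (Input K) = K := by
  simp [Input, Fintype.card_subtype_compl]

theorem infoRate_eq_blockRate (P : Measure (ℤ → Input K)) [IsProbabilityMeasure P]
    (ε : unitInterval) :
    infoRate P ε = blockRate fun S => erasureMean (ε : ℝ) S (blockEntropy P) := by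
  simp only [infoRate, blockRate, blockInfo_eq_erasureMean]

theorem IsInput.isStationaryPolymatroid_blockEntropy (hP : IsInput S P) :
    IsStationaryPolymatroid (blockEntropy P) :=
  have := hP.isProbabilityMeasure
  hP.isStationary.isStationaryPolymatroid_blockEntropy

theorem IsInput.tendsto_infoRate (hP : IsInput S P) (ε : unitInterval) :
    Tendsto (fun n : ℕ => blockInfo P ε n / n) atTop (𝓝 (infoRate P ε)) := by
  have := hP.isProbabilityMeasure
  simp only [infoRate_eq_blockRate, blockInfo_eq_erasureMean]
  exact (hP.isStationaryPolymatroid_blockEntropy.erasureMean ε.2).tendsto_blockRate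

theorem IsInput.infoRate_le_log (hP : IsInput S P) (ε : unitInterval) :
    infoRate P ε ≤ Real.log K := by
  have := hP.isProbabilityMeasure
  have hpoly := hP.isStationaryPolymatroid_blockEntropy
  calc infoRate P ε ≤ erasureMean (ε : ℝ) {1} (blockEntropy P) := by
        rw [infoRate_eq_blockRate]
        exact (hpoly.erasureMean ε.2).blockRate_le_singleton
    _ = (1 - (ε : ℝ)) * blockEntropy P {1} := by
        rw [erasureMean_singleton, hpoly.empty, mul_zero, zero_add]
    _ ≤ blockEntropy P {1} := mul_le_of_le_one_left (hpoly.nonneg _) (by linarith [ε.2.1])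
    _ ≤ Real.log K := by simpa [card_input] using blockEntropy_singleton_le_log_card P 1

end InfoRate

section Words

theorem word_succ {A : Type*} (x : ℤ → A) (i : ℤ) (n : ℕ) :
    word x i (n + 1) = word x i n ++ [x (i + n)] := by
  simp [word, -List.ofFn_succ, List.ofFn_succ_last]

theorem word_succ_left {A : Type*} (x : ℤ → A) (i : ℤ) (n : ℕ) :
    word x i (n + 1) = x i :: word x (i + 1) n := by
  simp only [word, List.ofFn_succ, Fin.val_zero, Fin.val_succ]
  push_cast
  simp only [add_zero, add_assoc, add_comm (1 : ℤ)]

theorem word_eq_append_singleton_iff {A : Type*} {x : ℤ → A} {i : ℤ} {w : List A} {a : A} :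
    word x i (w ++ [a]).length = w ++ [a] ↔ word x i w.length = w ∧ x (i + w.length) = a := by
  rw [List.length_append, List.length_singleton, word_succ]
  simp

theorem word_eq_cons_iff {A : Type*} {x : ℤ → A} {i : ℤ} {w : List A} {a : A} :
    word x i (a :: w).length = a :: w ↔ word x (i + 1) w.length = w ∧ x i = a := by
  rw [List.length_cons, word_succ_left, List.cons.injEq, and_comm]

theorem word_add_one {A : Type*} (x : ℤ → A) (i : ℤ) (n : ℕ) :
    word x (i + 1) n = word (fun k => x (k + 1)) i n := by
  simp only [word, add_right_comm]

theorem sum_real_inter_preimage_singleton {Ω T : Type*} [MeasurableSpace Ω] [Fintype T]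
    [MeasurableSpace T] [MeasurableSingletonClass T] (P : Measure Ω) [IsFiniteMeasure P]
    (s : Set Ω) {f : Ω → T} (hf : Measurable f) : ∑ t, P.real (s ∩ f ⁻¹' {t}) = P.real s :=
  calc ∑ t, P.real (s ∩ f ⁻¹' {t}) = ∑ t, ((P.restrict s).map f).real {t} := by
        refine Finset.sum_congr rfl fun t _ => ?_
        rw [map_measureReal_apply hf (measurableSet_singleton t),
          measureReal_restrict_apply (hf (measurableSet_singleton t)), Set.inter_comm]
    _ = P.real s := by
        rw [sum_measureReal_singleton, Finset.coe_univ, map_measureReal_apply hf .univ,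
          Set.preimage_univ, measureReal_restrict_apply_univ]

variable {A : Type*} [MeasurableSpace A] {P : Measure (ℤ → A)}

theorem wordProb_nonneg (P : Measure (ℤ → A)) (i : ℤ) (w : List A) : 0 ≤ wordProb P i w :=
  measureReal_nonneg

theorem wordProb_nil (P : Measure (ℤ → A)) [IsProbabilityMeasure P] (i : ℤ) :
    wordProb P i [] = 1 := by
  simp [wordProb, word]

variable [MeasurableSingletonClass A]

theorem measurableSet_word_eq [Countable A] (i : ℤ) (w : List A) :
    MeasurableSet {x : ℤ → A | word x i w.length = w} :=
  (Set.to_countable {y : Fin w.length → A | List.ofFn y = w}).measurableSet.preimage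
    (measurable_pi_lambda _ fun k => measurable_pi_apply (i + (k : ℕ)))

theorem IsStationary.wordProb_add_one [Countable A] (hP : IsStationary P) (i : ℤ) (w : List A) :
    wordProb P (i + 1) w = wordProb P i w := by
  unfold wordProb
  simp only [word_add_one]
  exact hP.measureReal_preimage (measurableSet_word_eq i w).nullMeasurableSet

variable [Fintype A]

theorem sum_wordProb_append_singleton (P : Measure (ℤ → A)) [IsFiniteMeasure P] (i : ℤ)
    (w : List A) : ∑ a, wordProb P i (w ++ [a]) = wordProb P i w := by
  simp only [wordProb, word_eq_append_singleton_iff]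
  exact sum_real_inter_preimage_singleton P _ (measurable_pi_apply (i + w.length))

theorem sum_wordProb_cons (P : Measure (ℤ → A)) [IsFiniteMeasure P] (i : ℤ) (w : List A) :
    ∑ a, wordProb P i (a :: w) = wordProb P (i + 1) w := by
  simp only [wordProb, word_eq_cons_iff]
  exact sum_real_inter_preimage_singleton P _ (measurable_pi_apply i)

end Words

section ShortBlocks

variable {A : Type*} [Fintype A] [MeasurableSpace A] [MeasurableSingletonClass A]

theorem blockEntropy_eq_sum (P : Measure (ℤ → A)) [IsProbabilityMeasure P] {T : Type*}
    [Fintype T] [MeasurableSpace T] [MeasurableSingletonClass T] {S : Finset ℤ}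
    {f : (ℤ → A) → T} (hf : Measurable f) (h : ∀ x y, f x = f y ↔ ∀ i ∈ S, x i = y i) :
    blockEntropy P S = ∑ t, Real.negMulLog (P.real (f ⁻¹' {t})) := by
  simp only [blockEntropy_eq_entropy_map P hf h, entropy,
    map_measureReal_apply hf (measurableSet_singleton _)]

variable (P : Measure (ℤ → A)) [IsProbabilityMeasure P]

theorem blockEntropy_one_eq_sum : blockEntropy P {1} = ∑ a, Real.negMulLog (wordProb P 1 [a]) := by
  rw [blockEntropy_eq_sum P (measurable_pi_apply 1) fun x y => by simp]
  simp only [wordProb, word_eq_cons_iff]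
  simp [word, Set.preimage]

theorem blockEntropy_one_two_eq_sum :
    blockEntropy P {1, 2} = ∑ a, ∑ b, Real.negMulLog (wordProb P 1 [a, b]) := by
  rw [blockEntropy_eq_sum P ((measurable_pi_apply 1).prodMk (measurable_pi_apply 2))
    fun x y => by simp, Fintype.sum_prod_type]
  simp [wordProb, word, Set.preimage]

theorem blockEntropy_one_two_three_eq_sum :
    blockEntropy P {1, 2, 3} = ∑ a, ∑ b, ∑ c, Real.negMulLog (wordProb P 1 [a, b, c]) := by
  rw [blockEntropy_eq_sum P ((measurable_pi_apply 1).prodMk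
    ((measurable_pi_apply 2).prodMk (measurable_pi_apply 3))) fun x y => by simp,
    Fintype.sum_prod_type]
  simp [wordProb, word, Set.preimage, Fintype.sum_prod_type]

theorem blockEntropy_one_three_eq_sum :
    blockEntropy P {1, 3} = ∑ a, ∑ c, Real.negMulLog (∑ b, wordProb P 1 [a, b, c]) := by
  rw [blockEntropy_eq_sum P ((measurable_pi_apply 1).prodMk (measurable_pi_apply 3))
    fun x y => by simp, Fintype.sum_prod_type]
  refine Finset.sum_congr rfl fun a _ => Finset.sum_congr rfl fun c _ => congrArg _ ?_
  rw [← sum_real_inter_preimage_singleton P _ (measurable_pi_apply 2)]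
  refine Finset.sum_congr rfl fun b _ => congrArg P.real ?_
  ext x
  simp [word]
  tauto

end ShortBlocks

section Rll

/-- The letter `1`. -/
def one : Input 2 := ⟨1, by decide⟩

/-- The letter `2`. -/
def two : Input 2 := ⟨2, by decide⟩

theorem one_ne_two : one ≠ two := by decide

theorem sum_input {M : Type*} [AddCommMonoid M] (g : Input 2 → M) : ∑ a, g a = g one + g two := by
  have huniv : (Finset.univ : Finset (Input 2)) = {one, two} := by decide
  rw [huniv, Finset.sum_pair one_ne_two]

theorem IsInput.wordProb_eq_zero {K : ℕ} {S : Set (List (Input K))} {P : Measure (ℤ → Input K)}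
    (hP : IsInput S P) {w : List (Input K)} (hw : w ∉ S) (i : ℤ) : wordProb P i w = 0 := by
  by_contra h
  exact hw (hP.words_subset ⟨i, (wordProb_nonneg P i w).lt_of_ne' h⟩)

variable {P : Measure (ℤ → Input 2)}

theorem IsInput.wordProb_eq_zero_of_infix (hP : IsInput rll P) {w : List (Input 2)}
    (hw : [two, two] <:+: w) (i : ℤ) : wordProb P i w = 0 :=
  hP.wordProb_eq_zero (fun h => h _ rfl hw) i

theorem wordProb_one [IsProbabilityMeasure P] (i : ℤ) :
    wordProb P i [one] = 1 - wordProb P i [two] := by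
  have h := sum_wordProb_append_singleton P i []
  rw [sum_input, wordProb_nil] at h
  exact eq_sub_of_add_eq h

theorem wordProb_append_one [IsFiniteMeasure P] (i : ℤ) (w : List (Input 2)) :
    wordProb P i (w ++ [one]) = wordProb P i w - wordProb P i (w ++ [two]) := by
  rw [← sum_wordProb_append_singleton P i w, sum_input, add_sub_cancel_right]

theorem IsInput.wordProb_two_one (hP : IsInput rll P) (i : ℤ) :
    wordProb P i [two, one] = wordProb P i [two] := by
  have := hP.isProbabilityMeasure
  have h : wordProb P i [two, one] = wordProb P i [two] - wordProb P i [two, two] :=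
    wordProb_append_one i [two]
  rwa [hP.wordProb_eq_zero_of_infix List.infix_rfl, sub_zero] at h

theorem IsInput.wordProb_one_two_append (hP : IsInput rll P) (i : ℤ) (w : List (Input 2)) :
    wordProb P i (one :: two :: w) = wordProb P i (two :: w) := by
  have := hP.isProbabilityMeasure
  have h := sum_wordProb_cons P i (two :: w)
  rwa [sum_input, hP.isStationary.wordProb_add_one,
    hP.wordProb_eq_zero_of_infix (w := two :: two :: w) (List.prefix_append _ w).isInfix,
    add_zero] at h

theorem IsInput.wordProb_one_one (hP : IsInput rll P) (i : ℤ) :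
    wordProb P i [one, one] = 1 - 2 * wordProb P i [two] := by
  have := hP.isProbabilityMeasure
  have h : wordProb P i [one, one] = wordProb P i [one] - wordProb P i [one, two] :=
    wordProb_append_one i [one]
  rw [h, wordProb_one, hP.wordProb_one_two_append]
  ring

theorem IsInput.wordProb_two_one_one (hP : IsInput rll P) (i : ℤ) :
    wordProb P i [two, one, one] = wordProb P i [two] - wordProb P i [two, one, two] := by
  have := hP.isProbabilityMeasure
  rw [← hP.wordProb_two_one]
  exact wordProb_append_one i [two, one]

theorem IsInput.wordProb_one_one_two (hP : IsInput rll P) (i : ℤ) :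
    wordProb P i [one, one, two] = wordProb P i [two] - wordProb P i [two, one, two] := by
  have := hP.isProbabilityMeasure
  have h := sum_wordProb_cons P i [one, two]
  rw [sum_input, hP.isStationary.wordProb_add_one, hP.wordProb_one_two_append] at h
  exact eq_sub_of_add_eq h

theorem IsInput.wordProb_one_one_one (hP : IsInput rll P) (i : ℤ) :
    wordProb P i [one, one, one] =
      1 - 3 * wordProb P i [two] + wordProb P i [two, one, two] := by
  have := hP.isProbabilityMeasure
  have h : wordProb P i [one, one, one] = wordProb P i [one, one] - wordProb P i [one, one, two] :=
    wordProb_append_one i [one, one]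
  rw [h, hP.wordProb_one_one, hP.wordProb_one_one_two]
  ring

theorem IsInput.blockEntropy_one (hP : IsInput rll P) :
    blockEntropy P {1} =
      Real.negMulLog (1 - wordProb P 1 [two]) + Real.negMulLog (wordProb P 1 [two]) := by
  have := hP.isProbabilityMeasure
  rw [blockEntropy_one_eq_sum, sum_input, wordProb_one]

theorem IsInput.blockEntropy_one_two (hP : IsInput rll P) :
    blockEntropy P {1, 2} =
      Real.negMulLog (1 - 2 * wordProb P 1 [two]) + 2 * Real.negMulLog (wordProb P 1 [two]) := by
  have := hP.isProbabilityMeasure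
  rw [blockEntropy_one_two_eq_sum]
  simp only [sum_input, hP.wordProb_one_one, hP.wordProb_one_two_append, hP.wordProb_two_one,
    hP.wordProb_eq_zero_of_infix List.infix_rfl, Real.negMulLog_zero]
  ring

theorem IsInput.blockEntropy_one_two_three (hP : IsInput rll P) :
    blockEntropy P {1, 2, 3} =
      Real.negMulLog (1 - 3 * wordProb P 1 [two] + wordProb P 1 [two, one, two]) +
      2 * Real.negMulLog (wordProb P 1 [two] - wordProb P 1 [two, one, two]) +
      Real.negMulLog (wordProb P 1 [two]) + Real.negMulLog (wordProb P 1 [two, one, two]) := by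
  have := hP.isProbabilityMeasure
  have h122 := hP.wordProb_eq_zero_of_infix (w := [one, two, two]) (by decide) 1
  have h221 := hP.wordProb_eq_zero_of_infix (w := [two, two, one]) (by decide) 1
  have h222 := hP.wordProb_eq_zero_of_infix (w := [two, two, two]) (by decide) 1
  rw [blockEntropy_one_two_three_eq_sum]
  simp only [sum_input, h122, h221, h222, hP.wordProb_one_two_append, hP.wordProb_two_one,
    hP.wordProb_one_one_one, hP.wordProb_one_one_two, hP.wordProb_two_one_one,
    Real.negMulLog_zero]
  ring

theorem IsInput.blockEntropy_one_three (hP : IsInput rll P) :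
    blockEntropy P {1, 3} =
      Real.negMulLog (1 - 2 * wordProb P 1 [two] + wordProb P 1 [two, one, two]) +
      2 * Real.negMulLog (wordProb P 1 [two] - wordProb P 1 [two, one, two]) +
      Real.negMulLog (wordProb P 1 [two, one, two]) := by
  have := hP.isProbabilityMeasure
  have h122 := hP.wordProb_eq_zero_of_infix (w := [one, two, two]) (by decide) 1
  have h221 := hP.wordProb_eq_zero_of_infix (w := [two, two, one]) (by decide) 1
  have h222 := hP.wordProb_eq_zero_of_infix (w := [two, two, two]) (by decide) 1
  rw [blockEntropy_one_three_eq_sum]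
  simp only [sum_input, h122, h221, h222, hP.wordProb_one_two_append, hP.wordProb_two_one,
    hP.wordProb_one_one_one, hP.wordProb_one_one_two, hP.wordProb_two_one_one, add_zero]
  ring_nf

end Rll

section GoldenRatio

open Real

theorem inv_goldenRatio_eq_sub_one : goldenRatio⁻¹ = goldenRatio - 1 := by
  rw [inv_goldenRatio, ← one_sub_goldenRatio]
  ring

theorem inv_goldenRatio_sq : goldenRatio⁻¹ ^ 2 = 1 - goldenRatio⁻¹ := by
  rw [inv_goldenRatio_eq_sub_one]
  linear_combination goldenRatio_sq

theorem one_sub_inv_goldenRatio_cube : 1 - goldenRatio⁻¹ ^ 3 = 2 * goldenRatio⁻¹ ^ 2 := by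
  linear_combination (-1 - goldenRatio⁻¹) * inv_goldenRatio_sq

theorem inv_goldenRatio_pow_mem_Ioo {n : ℕ} (hn : n ≠ 0) :
    goldenRatio⁻¹ ^ n ∈ Set.Ioo (0 : ℝ) 1 :=
  ⟨pow_pos (inv_pos.2 goldenRatio_pos) n,
    pow_lt_one₀ (by positivity) (inv_lt_one_of_one_lt₀ one_lt_goldenRatio) hn⟩

/-- The probability of the letter `2` under the process of maximal entropy. -/
def goldenMass : ℝ := 1 / (1 + goldenRatio ^ 2)

theorem goldenMass_mul : goldenMass * (1 + goldenRatio ^ 2) = 1 :=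
  div_mul_cancel₀ 1 (by positivity)

theorem goldenMass_mem_Icc : goldenMass ∈ Set.Icc (0 : ℝ) 1 :=
  ⟨by unfold goldenMass; positivity, div_le_one_of_le₀ (by nlinarith) (by positivity)⟩

end GoldenRatio

section UpperBound

theorem negMulLog_add_negMulLog_sub_le {x y r : ℝ} (hx : 0 ≤ x) (hy : 0 ≤ y) (hxy : x + y ≤ 1)
    (hr : r ∈ Set.Ioo (0 : ℝ) 1) :
    Real.negMulLog x + Real.negMulLog y - Real.negMulLog (x + y) ≤
      -(x * Real.log (1 - r)) - y * Real.log r - (y - r * (x + y)) ^ 2 / 4 := by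
  rcases (add_nonneg hx hy).eq_or_lt with h | h
  · obtain rfl : x = 0 := by linarith
    obtain rfl : y = 0 := by linarith
    simp
  have hr0 := hr.1
  have hr1 : 0 < 1 - r := sub_pos.2 hr.2
  have hx' := negMulLog_le_neg_mul_log_add_sub (p := x) (q := (1 - r) * (x + y)) hx
    (by positivity) fun h0 => absurd h0 (by positivity)
  have hy' := negMulLog_le_neg_mul_log_add_sub_sub_sq (p := y) (q := r * (x + y))
    ⟨hy, by linarith⟩ ⟨by positivity, mul_le_one₀ hr.2.le h.le hxy⟩
    fun h0 => absurd h0 (by positivity)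
  rw [Real.log_mul hr1.ne' h.ne'] at hx'
  rw [Real.log_mul hr0.ne' h.ne'] at hy'
  have hxy' : Real.negMulLog (x + y) = -(x + y) * Real.log (x + y) := rfl
  linarith

theorem negMulLog_golden_split_le {x y : ℝ} (hx : 0 ≤ x) (hy : 0 ≤ y) (hxy : x + y ≤ 1) :
    Real.negMulLog x + Real.negMulLog y - Real.negMulLog (x + y) ≤
      Real.log Real.goldenRatio * (x + 2 * y) -
        (y - Real.goldenRatio⁻¹ ^ 2 * (x + y)) ^ 2 / 4 := by
  have h := negMulLog_add_negMulLog_sub_le hx hy hxy (inv_goldenRatio_pow_mem_Ioo two_ne_zero)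
  rw [inv_goldenRatio_sq, sub_sub_cancel, ← inv_goldenRatio_sq, Real.log_pow, Real.log_inv] at h
  push_cast at h
  linarith

theorem negMulLog_golden_cube_split_le {x y : ℝ} (hx : 0 ≤ x) (hy : 0 ≤ y) (hxy : x + y ≤ 1) :
    Real.negMulLog x + Real.negMulLog y - Real.negMulLog (x + y) ≤
      Real.log Real.goldenRatio * (2 * x + 3 * y) - Real.log 2 * x := by
  have h := negMulLog_add_negMulLog_sub_le hx hy hxy (inv_goldenRatio_pow_mem_Ioo three_ne_zero)
  rw [one_sub_inv_goldenRatio_cube, Real.log_mul two_ne_zero (by positivity), Real.log_pow,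
    Real.log_pow, Real.log_inv] at h
  push_cast at h
  linarith [sq_nonneg (y - Real.goldenRatio⁻¹ ^ 3 * (x + y))]

theorem negMulLog_half_split_le {x y : ℝ} (hx : 0 ≤ x) (hy : 0 ≤ y) (hxy : x + y ≤ 1) :
    Real.negMulLog x + Real.negMulLog y - Real.negMulLog (x + y) ≤ (x + y) * Real.log 2 := by
  have h := negMulLog_add_negMulLog_sub_le (r := 2⁻¹) hx hy hxy (by norm_num)
  rw [show (1 : ℝ) - 2⁻¹ = 2⁻¹ by norm_num, Real.log_inv] at h
  linarith [sq_nonneg (y - 2⁻¹ * (x + y))]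

/-- The amount by which the probability of `a12` exceeds the one forced by the transition
probability `φ⁻²` from `1` to `2` of the chain of maximal entropy. -/
def goldenDefect (P : Measure (ℤ → Input 2)) (a : Input 2) : ℝ :=
  wordProb P 1 [a, one, two] - Real.goldenRatio⁻¹ ^ 2 * wordProb P 1 [a, one]

/-- The probability that both neighbours of a letter are `1`, which leaves that letter free under
the RLL constraint. -/
def freeProb (P : Measure (ℤ → Input 2)) : ℝ :=
  ∑ b, wordProb P 1 [one, b, one]

variable {P : Measure (ℤ → Input 2)}

theorem IsInput.freeProb_eq (hP : IsInput rll P) :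
    freeProb P = 1 - 2 * wordProb P 1 [two] + wordProb P 1 [two, one, two] := by
  rw [freeProb, sum_input, hP.wordProb_one_one_one, hP.wordProb_one_two_append,
    hP.wordProb_two_one]
  ring

theorem IsInput.freeProb_eq_sub_goldenDefect (hP : IsInput rll P) :
    freeProb P = 2 * goldenMass - (Real.goldenRatio * (1 - goldenMass) * goldenDefect P one +
      (Real.goldenRatio * (1 - goldenMass) - 1) * goldenDefect P two) := by
  have hφ := Real.goldenRatio_sq
  have hM := goldenMass_mul
  simp only [hP.freeProb_eq, goldenDefect, hP.wordProb_one_one_two, hP.wordProb_one_one,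
    hP.wordProb_two_one, inv_goldenRatio_eq_sub_one]
  grind

theorem freeProb_nonneg (P : Measure (ℤ → Input 2)) : 0 ≤ freeProb P :=
  Finset.sum_nonneg fun _ _ => wordProb_nonneg P 1 _

theorem IsInput.freeProb_le_one (hP : IsInput rll P) : freeProb P ≤ 1 := by
  rw [hP.freeProb_eq]
  linarith [hP.wordProb_two_one_one 1, wordProb_nonneg P 1 [two, one, one],
    wordProb_nonneg P 1 [two]]

theorem IsInput.blockEntropy_one_two_three_sub_le (hP : IsInput rll P) :
    blockEntropy P {1, 2, 3} - blockEntropy P {1, 2} ≤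
      Real.log Real.goldenRatio - (goldenDefect P one ^ 2 + goldenDefect P two ^ 2) / 4 := by
  have h111 := hP.wordProb_one_one_one 1 ▸ wordProb_nonneg P 1 [one, one, one]
  have h112 := hP.wordProb_one_one_two 1 ▸ wordProb_nonneg P 1 [one, one, two]
  have h2 := wordProb_nonneg P 1 [two]
  have h212 := wordProb_nonneg P 1 [two, one, two]
  have hone := negMulLog_golden_split_le h111 h112 (by linarith)
  have htwo := negMulLog_golden_split_le h112 h212 (by linarith)
  rw [hP.blockEntropy_one_two_three, hP.blockEntropy_one_two]
  simp only [goldenDefect, hP.wordProb_one_one_two, hP.wordProb_one_one, hP.wordProb_two_one]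
  ring_nf at hone htwo ⊢
  linarith

theorem IsInput.blockEntropy_one_two_sub_le (hP : IsInput rll P) :
    blockEntropy P {1, 2} - blockEntropy P {1} ≤ Real.log Real.goldenRatio := by
  have h11 := hP.wordProb_one_one 1 ▸ wordProb_nonneg P 1 [one, one]
  have h2 := wordProb_nonneg P 1 [two]
  have hsplit := (negMulLog_golden_split_le h11 h2 (by linarith)).trans
    (sub_le_self _ (by positivity))
  rw [hP.blockEntropy_one_two, hP.blockEntropy_one]
  ring_nf at hsplit ⊢
  linarith

theorem IsInput.blockEntropy_one_three_sub_le (hP : IsInput rll P) :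
    blockEntropy P {1, 3} - blockEntropy P {1} ≤
      2 * Real.log Real.goldenRatio - Real.log 2 * freeProb P := by
  have h1b1 := hP.freeProb_eq ▸ freeProb_nonneg P
  have h112 := hP.wordProb_one_one_two 1 ▸ wordProb_nonneg P 1 [one, one, two]
  have h212 := wordProb_nonneg P 1 [two, one, two]
  have hone := negMulLog_golden_cube_split_le h1b1 h112 (by linarith)
  have htwo := (negMulLog_golden_split_le h112 h212 (by linarith)).trans
    (sub_le_self _ (by positivity))
  rw [hP.blockEntropy_one_three, hP.blockEntropy_one, hP.freeProb_eq]
  ring_nf at hone htwo ⊢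
  linarith

theorem IsInput.blockEntropy_one_two_three_sub_one_three_le (hP : IsInput rll P) :
    blockEntropy P {1, 2, 3} - blockEntropy P {1, 3} ≤ freeProb P * Real.log 2 := by
  have h111 := hP.wordProb_one_one_one 1 ▸ wordProb_nonneg P 1 [one, one, one]
  have h2 := wordProb_nonneg P 1 [two]
  have hfree := hP.freeProb_le_one
  rw [hP.freeProb_eq] at hfree ⊢
  have hsplit := negMulLog_half_split_le h111 h2 (by linarith)
  rw [hP.blockEntropy_one_two_three, hP.blockEntropy_one_three]
  ring_nf at hsplit ⊢
  linarith

theorem sub_sq_le_of_abs_le_two {t k x : ℝ} (hk : |k| ≤ 2) :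
    t * (k * x) - x ^ 2 / 32 ≤ 32 * t ^ 2 := by
  have hk2 : k ^ 2 ≤ 2 ^ 2 := sq_le_sq.2 (by simpa using hk)
  nlinarith [sq_nonneg (x / 8 - 2 * t * k), mul_le_mul_of_nonneg_left hk2 (sq_nonneg t)]

theorem erasure_polynomial_le {t L q c d : ℝ} (ht0 : 0 ≤ t) (ht : t ≤ 1 / 2) (hL : 0 ≤ L)
    (hq : 0 ≤ q) (hc0 : 0 ≤ c) (hc : c ≤ 1) (hd : d ≤ 1) :
    (1 - t) * ((1 - t) ^ 2 * (L - q / 4) + t * (1 - t) * (L + (2 * L - c)) + t ^ 2 * d) ≤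
      L - q / 32 - t * c + 3 * t ^ 2 := by
  have ht1 : 0 ≤ 1 - t := by linarith
  have hL' : ((1 - t) ^ 3 + 3 * (t * (1 - t) ^ 2)) * L ≤ 1 * L :=
    mul_le_mul_of_nonneg_right (by nlinarith [mul_nonneg (sq_nonneg t) ht1]) hL
  have hq' : (1 / 2) ^ 3 * (q / 4) ≤ (1 - t) ^ 3 * (q / 4) := by gcongr; linarith
  have hc' : t * c * (1 - 2 * t) ≤ t * c * (1 - t) ^ 2 :=
    mul_le_mul_of_nonneg_left (by nlinarith) (mul_nonneg ht0 hc0)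
  have hct : t ^ 2 * c ≤ t ^ 2 * 1 := by gcongr
  have hd' : (1 - t) * t ^ 2 * d ≤ 1 * t ^ 2 * 1 := by
    calc (1 - t) * t ^ 2 * d ≤ (1 - t) * t ^ 2 * 1 := by gcongr
      _ ≤ 1 * t ^ 2 * 1 := by gcongr; linarith
  linarith

theorem log_two_mem_Icc : Real.log 2 ∈ Set.Icc (0 : ℝ) 1 :=
  ⟨Real.log_nonneg one_le_two, by linarith [Real.log_two_lt_d9]⟩

theorem IsInput.infoRate_le_sub_goldenDefect (hP : IsInput rll P) {ε : unitInterval}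
    (hε : (ε : ℝ) ≤ 1 / 2) :
    infoRate P ε ≤ Real.log Real.goldenRatio -
      (goldenDefect P one ^ 2 + goldenDefect P two ^ 2) / 32 - ε * (Real.log 2 * freeProb P) +
      3 * (ε : ℝ) ^ 2 := by
  have := hP.isProbabilityMeasure
  have hpoly := hP.isStationaryPolymatroid_blockEntropy
  have hfree0 := freeProb_nonneg P
  have hH1 : blockEntropy P {1} ≤ Real.log 2 := by
    simpa [card_input] using blockEntropy_singleton_le_log_card P 1
  have hε0 : (0 : ℝ) ≤ ε := ε.2.1
  have hε1 : (0 : ℝ) ≤ 1 - ε := by linarith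
  calc infoRate P ε ≤ erasureMean (ε : ℝ) {1, 2, 3} (blockEntropy P) -
        erasureMean (ε : ℝ) {1, 2} (blockEntropy P) := by
        rw [infoRate_eq_blockRate]
        exact (hpoly.erasureMean ε.2).blockRate_le_increment 2
    _ ≤ (1 - ε) * ((1 - ε) ^ 2 * (Real.log Real.goldenRatio -
          (goldenDefect P one ^ 2 + goldenDefect P two ^ 2) / 4) +
        ε * (1 - ε) * (Real.log Real.goldenRatio +
          (2 * Real.log Real.goldenRatio - Real.log 2 * freeProb P)) +
        ε ^ 2 * blockEntropy P {1}) := by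
        rw [hpoly.erasureMean_triple_sub_pair]
        gcongr (1 - (ε : ℝ)) * ((1 - (ε : ℝ)) ^ 2 * ?_ + (ε : ℝ) * (1 - (ε : ℝ)) * (?_ + ?_) + _)
        · exact hP.blockEntropy_one_two_three_sub_le
        · exact hP.blockEntropy_one_two_sub_le
        · exact hP.blockEntropy_one_three_sub_le
    _ ≤ _ := erasure_polynomial_le hε0 hε (Real.log_nonneg Real.one_lt_goldenRatio.le)
        (by positivity) (mul_nonneg log_two_mem_Icc.1 hfree0)
        (mul_le_one₀ log_two_mem_Icc.2 hfree0 hP.freeProb_le_one) (hH1.trans log_two_mem_Icc.2)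

-- The defects enter `freeProb P` linearly with coefficients in `[-2, 2]`, and the quadratic gain
-- pays for them up to `O(ε²)`.
theorem IsInput.infoRate_le_expansion (hP : IsInput rll P) {ε : unitInterval}
    (hε : (ε : ℝ) ≤ 1 / 2) :
    infoRate P ε ≤ Real.log Real.goldenRatio - 2 * Real.log 2 * goldenMass * ε +
      67 * (ε : ℝ) ^ 2 := by
  have hlog2 := log_two_mem_Icc
  have hcoeff : Real.goldenRatio * (1 - goldenMass) ∈ Set.Icc (0 : ℝ) 2 :=
    ⟨mul_nonneg Real.goldenRatio_pos.le (sub_nonneg.2 goldenMass_mem_Icc.2),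
      by nlinarith [Real.goldenRatio_pos, Real.goldenRatio_lt_two, goldenMass_mem_Icc.1]⟩
  have hrate := hP.infoRate_le_sub_goldenDefect hε
  rw [hP.freeProb_eq_sub_goldenDefect] at hrate
  generalize Real.goldenRatio * (1 - goldenMass) = k at hcoeff hrate
  have hone := sub_sq_le_of_abs_le_two (t := ε) (k := Real.log 2 * k) (x := goldenDefect P one)
    (abs_le.2 (by constructor <;> nlinarith [hlog2.1, hlog2.2, hcoeff.1, hcoeff.2]))
  have htwo := sub_sq_le_of_abs_le_two (t := ε) (k := Real.log 2 * (k - 1))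
    (x := goldenDefect P two)
    (abs_le.2 (by constructor <;> nlinarith [hlog2.1, hlog2.2, hcoeff.1, hcoeff.2]))
  linarith

end UpperBound

section RunParityChain

theorem eq_one_or_eq_two (a : Input 2) : a = one ∨ a = two := by
  revert a
  decide

/-- In the binary sequence `e`, exactly `r` consecutive zeros end at time `k`. -/
def ZeroRun (e : ℤ → Fin 2) : ℤ → ℕ → Prop
  | k, 0 => e k ≠ 0
  | k, r + 1 => e k = 0 ∧ ZeroRun e (k - 1) r

theorem ZeroRun.unique {e : ℤ → Fin 2} {k : ℤ} {r s : ℕ} (hr : ZeroRun e k r)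
    (hs : ZeroRun e k s) : r = s := by
  induction r generalizing k s with
  | zero =>
    cases s with
    | zero => rfl
    | succ s => exact absurd hs.1 hr
  | succ r ih =>
    cases s with
    | zero => exact absurd hr.1 hs
    | succ s => rw [ih hr.2 hs.2]

theorem zeroRun_succ {e : ℤ → Fin 2} {k : ℤ} {r : ℕ} :
    ZeroRun e (k + 1) (r + 1) ↔ e (k + 1) = 0 ∧ ZeroRun e k r := by
  rw [ZeroRun, add_sub_cancel_right]

theorem exists_zeroRun {e : ℤ → Fin 2} {k : ℤ} {r : ℕ} (h : e (k - r) ≠ 0) :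
    ∃ s, ZeroRun e k s := by
  induction r generalizing k with
  | zero => exact ⟨0, by simpa [ZeroRun] using h⟩
  | succ r ih =>
    by_cases hk : e k = 0
    · obtain ⟨s, hs⟩ := ih (k := k - 1) (by rwa [sub_sub, add_comm, ← Nat.cast_succ])
      exact ⟨s + 1, hk, hs⟩
    · exact ⟨0, hk⟩

theorem zeroRun_shift {e : ℤ → Fin 2} {k : ℤ} {r : ℕ} :
    ZeroRun (fun j => e (j + 1)) k r ↔ ZeroRun e (k + 1) r := by
  induction r generalizing k with
  | zero => rfl
  | succ r ih => rw [zeroRun_succ, ZeroRun, ih, sub_add_cancel]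

open Classical in
/-- The sequence over `{1, 2}` driven by the binary sequence `e`: a letter `1` is followed by `2`
where `e` vanishes and by `1` elsewhere, and a letter `2` is followed by `1`. The letter at time
`k` is thus `2` exactly when the run of zeros of `e` that ends at `k` has odd length, which defines
the two-sided sequence without an initial letter. -/
def chain (e : ℤ → Fin 2) (k : ℤ) : Input 2 :=
  if ∃ r, Odd r ∧ ZeroRun e k r then two else one

/-- The letter that follows `b` in `chain e` when `e` takes the value `u`. -/
def chainStep (b : Input 2) (u : Fin 2) : Input 2 :=
  if b = one ∧ u = 0 then two else one

theorem ZeroRun.chain_eq {e : ℤ → Fin 2} {k : ℤ} {r : ℕ} (h : ZeroRun e k r) :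
    chain e k = if Odd r then two else one := by
  have hodd : (∃ s, Odd s ∧ ZeroRun e k s) ↔ Odd r :=
    ⟨fun ⟨_, hs, hrun⟩ => h.unique hrun ▸ hs, fun hr => ⟨r, hr, h⟩⟩
  simp only [chain, hodd]

theorem chain_succ {e : ℤ → Fin 2} {k : ℤ} (h : ∃ r, ZeroRun e k r) :
    chain e (k + 1) = chainStep (chain e k) (e (k + 1)) := by
  obtain ⟨r, hr⟩ := h
  by_cases he : e (k + 1) = 0
  · rw [(zeroRun_succ.2 ⟨he, hr⟩).chain_eq, hr.chain_eq]
    by_cases hodd : Odd r <;> simp [chainStep, he, hodd, Nat.odd_add_one, one_ne_two.symm]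
  · have hrun : ZeroRun e (k + 1) 0 := he
    simp [hrun.chain_eq, chainStep, he]

theorem not_chain_two_two (e : ℤ → Fin 2) (k : ℤ) :
    ¬(chain e k = two ∧ chain e (k + 1) = two) := by
  rintro ⟨hk, hk1⟩
  have hrun : ∃ r, Odd r ∧ ZeroRun e k r := by
    by_contra hrun
    exact one_ne_two ((if_neg hrun).symm.trans hk)
  rw [chain_succ (hrun.imp fun _ => And.right), hk] at hk1
  exact absurd hk1 (by simp [chainStep, one_ne_two, one_ne_two.symm])

theorem word_chain_mem_rll (e : ℤ → Fin 2) (i : ℤ) (n : ℕ) : word (chain e) i n ∈ rll := by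
  rintro f rfl ⟨s, t, hst⟩
  have hlen : s.length + 1 < n := by
    have hsum : s.length + (t.length + 1 + 1) = n := by simpa [word] using congrArg List.length hst
    omega
  have hget (k : ℕ) (hk : k < n) :
      (word (chain e) i n)[k]? = some (chain e (i + k)) := by
    simp [word, hk]
  refine not_chain_two_two e (i + s.length) ⟨?_, ?_⟩
  · have := hget s.length (by omega)
    rw [← hst] at this
    simpa [two, eq_comm] using this
  · have := hget (s.length + 1) hlen
    rw [← hst] at this
    simpa [two, eq_comm, add_assoc] using this

theorem chain_shift (e : ℤ → Fin 2) (k : ℤ) :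
    chain (fun j => e (j + 1)) k = chain e (k + 1) := by
  classical
  exact if_congr (exists_congr fun _ => and_congr_right' zeroRun_shift) rfl rfl

theorem measurableSet_zeroRun (k : ℤ) (r : ℕ) :
    MeasurableSet[cylinderEvents (Set.Iic k)] {e : ℤ → Fin 2 | ZeroRun e k r} := by
  have hcoord (k : ℤ) (s : Set (Fin 2)) :
      MeasurableSet[cylinderEvents (Set.Iic k)] {e : ℤ → Fin 2 | e k ∈ s} :=
    measurable_cylinderEvent_apply (Set.mem_Iic.2 le_rfl) s.toFinite.measurableSet
  induction r generalizing k with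
  | zero => exact hcoord k {0}ᶜ
  | succ r ih =>
    exact (hcoord k {0}).inter
      (cylinderEvents_mono (Set.Iic_subset_Iic.2 (sub_one_lt k).le) _ (ih (k - 1)))

theorem measurable_chain_apply (k : ℤ) :
    Measurable[cylinderEvents (Set.Iic k)] fun e => chain e k := by
  classical
  refine Measurable.ite ?_ measurable_const measurable_const
  have hunion : {e : ℤ → Fin 2 | ∃ r, Odd r ∧ ZeroRun e k r} =
      ⋃ r : ℕ, ⋃ _ : Odd r, {e | ZeroRun e k r} := by
    ext e
    simp
  rw [hunion]
  exact .iUnion fun r => .iUnion fun _ => measurableSet_zeroRun k r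

theorem measurable_chain : Measurable chain :=
  measurable_pi_lambda _ fun k => (measurable_chain_apply k).mono cylinderEvents_le_pi le_rfl

theorem measurableSet_word_chain {i k : ℤ} {w : List (Input 2)} (hk : i + w.length ≤ k + 1) :
    MeasurableSet[cylinderEvents (Set.Iic k)] {e | word (chain e) i w.length = w} := by
  have hblock : Measurable[cylinderEvents (Set.Iic k)]
      fun (e : ℤ → Fin 2) (j : Fin w.length) => chain e (i + (j : ℕ)) := by
    rw [@measurable_pi_iff]
    exact fun j => (measurable_chain_apply _).mono
      (cylinderEvents_mono (Set.Iic_subset_Iic.2 (by omega))) le_rfl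
  exact hblock (Set.to_countable {y | List.ofFn y = w}).measurableSet

end RunParityChain

section ChainLaw

theorem isStationary_infinitePi {A : Type*} [MeasurableSpace A] (μ : Measure A)
    [IsProbabilityMeasure μ] : IsStationary (Measure.infinitePi fun _ : ℤ => μ) where
  measurable := by fun_prop
  map_eq := Measure.map_infinitePi_infinitePi_of_inj (P := fun _ : ℤ => μ) (add_left_injective 1)

theorem IsStationary.map {A B : Type*} [MeasurableSpace A] [MeasurableSpace B]
    {P : Measure (ℤ → A)} (hP : IsStationary P) {F : (ℤ → A) → ℤ → B} (hF : Measurable F)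
    (hshift : ∀ x k, F (fun j => x (j + 1)) k = F x (k + 1)) : IsStationary (P.map F) where
  measurable := by fun_prop
  map_eq := by
    conv_rhs => rw [← hP.map_eq]
    rw [Measure.map_map (by fun_prop) hF, Measure.map_map hF hP.measurable]
    congr 1
    ext x k
    exact (hshift x k).symm

theorem indep_cylinderEvents_infinitePi {ι : Type*} {X : ι → Type*}
    [∀ i, MeasurableSpace (X i)] (μ : ∀ i, Measure (X i)) [∀ i, IsProbabilityMeasure (μ i)]
    {S T : Set ι} (h : Disjoint S T) :
    ProbabilityTheory.Indep (cylinderEvents S) (cylinderEvents T) (Measure.infinitePi μ) :=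
  ProbabilityTheory.indep_iSup_of_disjoint (fun i => (measurable_pi_apply i).comap_le)
    (ProbabilityTheory.iIndepFun_infinitePi (X := fun _ u => u) fun _ => measurable_id).iIndep h

variable {p : unitInterval}

theorem ae_exists_zeroRun (hp : p ≠ 1) (k : ℤ) : ∀ᵐ e ∂erasureLaw p, ∃ r, ZeroRun e k r := by
  have hbound (n : ℕ) : (erasureLaw p).real {e | ¬∃ r, ZeroRun e k r} ≤ (p : ℝ) ^ n := by
    let recent : ℕ ↪ ℤ := ⟨fun r => k - r, fun _ _ h => by simpa using h⟩
    have hsub : {e | ¬∃ r, ZeroRun e k r} ⊆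
        Set.pi ((Finset.range n).map recent) fun _ => ({0} : Set (Fin 2)) := by
      intro e he j hj
      obtain ⟨r, -, rfl⟩ := Finset.mem_map.1 hj
      exact not_not.1 fun hne => he (exists_zeroRun hne)
    refine (measureReal_mono hsub).trans_eq ?_
    rw [measureReal_def, erasureLaw,
      Measure.infinitePi_pi _ fun _ _ => measurableSet_singleton _, ENNReal.toReal_prod]
    simp only [← measureReal_def, bernoulliMeasure_real_singleton, Finset.prod_const,
      Finset.card_map, Finset.card_range, zero_ne_one, if_false]
  have hlim : Tendsto (fun n : ℕ => (p : ℝ) ^ n) atTop (𝓝 0) :=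
    tendsto_pow_atTop_nhds_zero_of_lt_one p.2.1 (unitInterval.lt_one_iff_ne_one.2 hp)
  have hzero := (ge_of_tendsto' hlim hbound).antisymm measureReal_nonneg
  exact ae_iff.2 ((measureReal_eq_zero_iff).1 hzero)

/-- The law of the stationary Markov chain over `{1, 2}` in which `1` is followed by `2` with
probability `p` and `2` is always followed by `1`. -/
def chainLaw (p : unitInterval) : Measure (ℤ → Input 2) :=
  (erasureLaw p).map chain

instance (p : unitInterval) : IsProbabilityMeasure (chainLaw p) :=
  Measure.isProbabilityMeasure_map measurable_chain.aemeasurable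

theorem wordProb_chainLaw (p : unitInterval) (i : ℤ) (w : List (Input 2)) :
    wordProb (chainLaw p) i w = (erasureLaw p).real {e | word (chain e) i w.length = w} :=
  map_measureReal_apply measurable_chain (measurableSet_word_eq i w)

theorem isInput_chainLaw (p : unitInterval) : IsInput rll (chainLaw p) where
  isProbabilityMeasure := inferInstance
  isStationary := (isStationary_infinitePi _).map measurable_chain chain_shift
  words_subset := by
    rintro w ⟨i, hw⟩
    rw [wordProb_chainLaw] at hw
    obtain ⟨e, he⟩ := nonempty_of_measureReal_ne_zero hw.ne'
    have hword : word (chain e) i w.length = w := he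
    exact hword ▸ word_chain_mem_rll e i w.length

/-- The probability that `chainStep` leads from the letter `b` to the letter `a`. -/
def chainKernel (p : unitInterval) (b a : Input 2) : ℝ :=
  (ProbabilityTheory.bernoulliMeasure (0 : Fin 2) 1 p).real {u | chainStep b u = a}

theorem chainKernel_one_two (p : unitInterval) : chainKernel p one two = p := by
  have hset : {u | chainStep one u = two} = {0} := by
    ext u
    simp [chainStep, one_ne_two]
  rw [chainKernel, hset, bernoulliMeasure_real_singleton, if_neg zero_ne_one]

theorem chainKernel_one_one (p : unitInterval) : chainKernel p one one = 1 - p := by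
  have hset : {u | chainStep one u = one} = {1} := by
    ext u
    fin_cases u <;> simp [chainStep, one_ne_two.symm]
  rw [chainKernel, hset, bernoulliMeasure_real_singleton, if_pos rfl]

theorem chainKernel_two_one (p : unitInterval) : chainKernel p two one = 1 := by
  simp [chainKernel, chainStep, one_ne_two.symm]

theorem chainKernel_two_two (p : unitInterval) : chainKernel p two two = 0 := by
  simp [chainKernel, chainStep, one_ne_two, one_ne_two.symm]

theorem erasureLaw_real_chainStep (p : unitInterval) (k : ℤ) (b a : Input 2) :
    (erasureLaw p).real (Function.eval k ⁻¹' {u | chainStep b u = a}) = chainKernel p b a :=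
  (measurePreserving_eval_infinitePi _ k).measureReal_preimage
    MeasurableSet.of_discrete.nullMeasurableSet

theorem wordProb_chainLaw_append (hp : p ≠ 1) (i : ℤ) (w : List (Input 2)) (b a : Input 2) :
    wordProb (chainLaw p) i (w ++ [b] ++ [a]) =
      wordProb (chainLaw p) i (w ++ [b]) * chainKernel p b a := by
  set k : ℤ := i + w.length
  have hlen : i + ((w ++ [b]).length : ℤ) = k + 1 := by simp [k, add_assoc]
  set past := {e | word (chain e) i (w ++ [b]).length = w ++ [b]}
  set next : Set (ℤ → Fin 2) := Function.eval (k + 1) ⁻¹' {u | chainStep b u = a}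
  have hpast : MeasurableSet[cylinderEvents (Set.Iic k)] past :=
    measurableSet_word_chain hlen.le
  have hnext : MeasurableSet[cylinderEvents {k + 1}] next :=
    measurable_cylinderEvent_apply (Set.mem_singleton (k + 1)) .of_discrete
  have hindep : ProbabilityTheory.Indep (cylinderEvents (Set.Iic k)) (cylinderEvents {k + 1})
      (erasureLaw p) := indep_cylinderEvents_infinitePi _ (by simp)
  have hae : {e | word (chain e) i (w ++ [b] ++ [a]).length = w ++ [b] ++ [a]}
      =ᵐ[erasureLaw p] (past ∩ next : Set (ℤ → Fin 2)) := by
    filter_upwards [ae_exists_zeroRun hp k] with e hrun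
    refine propext (word_eq_append_singleton_iff.trans (and_congr_right fun hw => ?_))
    rw [hlen, chain_succ hrun, (word_eq_append_singleton_iff.1 hw).2]
    rfl
  calc wordProb (chainLaw p) i (w ++ [b] ++ [a]) = (erasureLaw p).real (past ∩ next) := by
        rw [wordProb_chainLaw, measureReal_congr hae]
    _ = (erasureLaw p).real past * (erasureLaw p).real next := by
        simp only [measureReal_def, ENNReal.toReal_mul,
          (ProbabilityTheory.Indep_iff _ _ _).1 hindep past next hpast hnext]
    _ = wordProb (chainLaw p) i (w ++ [b]) * chainKernel p b a := by
        rw [wordProb_chainLaw, erasureLaw_real_chainStep]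

theorem isMarkov_chainLaw (hp : p ≠ 1) {m : ℕ} (hm : 1 ≤ m) : IsMarkov m (chainLaw p) := by
  intro i u v a hv
  obtain ⟨v, b, rfl⟩ : ∃ v' b, v = v' ++ [b] :=
    (List.eq_nil_or_concat' v).resolve_left (by rintro rfl; simp at hv; omega)
  rw [← List.append_assoc u, wordProb_chainLaw_append hp, wordProb_chainLaw_append hp]
  ring

end ChainLaw

section GoldenChain

/-- The transition probability from `1` to `2` in the chain of maximal entropy. -/
def goldenParam : unitInterval :=
  ⟨Real.goldenRatio⁻¹ ^ 2, Set.Ioo_subset_Icc_self (inv_goldenRatio_pow_mem_Ioo two_ne_zero)⟩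

theorem coe_goldenParam : (goldenParam : ℝ) = Real.goldenRatio⁻¹ ^ 2 := rfl

theorem goldenParam_ne_one : goldenParam ≠ 1 :=
  unitInterval.lt_one_iff_ne_one.1 (inv_goldenRatio_pow_mem_Ioo two_ne_zero).2

/-- The law of the stationary chain of maximal entropy under the RLL constraint. -/
def goldenLaw : Measure (ℤ → Input 2) := chainLaw goldenParam

instance : IsProbabilityMeasure goldenLaw :=
  inferInstanceAs (IsProbabilityMeasure (chainLaw goldenParam))

theorem isInput_goldenLaw : IsInput rll goldenLaw := isInput_chainLaw goldenParam

theorem isMarkov_goldenLaw {m : ℕ} (hm : 1 ≤ m) : IsMarkov m goldenLaw :=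
  isMarkov_chainLaw goldenParam_ne_one hm

theorem wordProb_goldenLaw_append (i : ℤ) (w : List (Input 2)) (b a : Input 2) :
    wordProb goldenLaw i (w ++ [b] ++ [a]) =
      wordProb goldenLaw i (w ++ [b]) * chainKernel goldenParam b a :=
  wordProb_chainLaw_append goldenParam_ne_one i w b a

/-- A Perron vector of the adjacency matrix of the RLL constraint, which bounds the probability of a
word under `goldenLaw` in terms of its length and its last letter. -/
def perronWeight (a : Input 2) : ℝ :=
  if a = one then Real.goldenRatio else 1

theorem perronWeight_mem_Icc (a : Input 2) : perronWeight a ∈ Set.Icc 1 Real.goldenRatio := by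
  have hφ := Real.one_lt_goldenRatio.le
  unfold perronWeight
  split_ifs
  · exact ⟨hφ, le_rfl⟩
  · exact ⟨le_rfl, hφ⟩

theorem perronWeight_mul_chainKernel_le (b a : Input 2) :
    perronWeight b * chainKernel goldenParam b a ≤ Real.goldenRatio⁻¹ * perronWeight a := by
  have hφ := Real.goldenRatio_pos
  rcases eq_one_or_eq_two a with rfl | rfl <;> rcases eq_one_or_eq_two b with rfl | rfl <;>
    simp only [perronWeight, chainKernel_one_one, chainKernel_one_two, chainKernel_two_one,
      chainKernel_two_two, coe_goldenParam, if_true, one_ne_two.symm, if_false]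
  · rw [inv_goldenRatio_sq, sub_sub_cancel, mul_comm]
  · rw [inv_mul_cancel₀ hφ.ne', one_mul]
  · rw [sq, mul_inv_cancel_left₀ hφ.ne', mul_one]
  · rw [mul_zero]
    positivity

theorem wordProb_goldenLaw_append_singleton_le (i : ℤ) (w : List (Input 2)) (b : Input 2) :
    wordProb goldenLaw i (w ++ [b]) ≤ Real.goldenRatio⁻¹ ^ w.length * perronWeight b := by
  induction w using List.reverseRecOn generalizing b with
  | nil =>
    have hprob : wordProb goldenLaw i [b] ≤ 1 := measureReal_le_one
    simpa using hprob.trans (perronWeight_mem_Icc b).1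
  | append_singleton w c ih =>
    calc wordProb goldenLaw i (w ++ [c] ++ [b])
        = wordProb goldenLaw i (w ++ [c]) * chainKernel goldenParam c b :=
          wordProb_goldenLaw_append i w c b
      _ ≤ Real.goldenRatio⁻¹ ^ w.length * perronWeight c * chainKernel goldenParam c b :=
          mul_le_mul_of_nonneg_right (ih c) measureReal_nonneg
      _ ≤ Real.goldenRatio⁻¹ ^ w.length * (Real.goldenRatio⁻¹ * perronWeight b) := by
          rw [mul_assoc]
          gcongr ?_ * ?_
          exact perronWeight_mul_chainKernel_le c b
      _ = Real.goldenRatio⁻¹ ^ (w ++ [c]).length * perronWeight b := by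
          rw [List.length_append, List.length_singleton, pow_succ, mul_assoc]

theorem wordProb_goldenLaw_le (i : ℤ) (w : List (Input 2)) :
    wordProb goldenLaw i w ≤ Real.goldenRatio⁻¹ ^ w.length * Real.goldenRatio ^ 2 := by
  have hφ := Real.goldenRatio_pos
  rcases List.eq_nil_or_concat' w with rfl | ⟨w, b, rfl⟩
  · rw [wordProb_nil, List.length_nil, pow_zero, one_mul]
    exact one_le_pow₀ Real.one_lt_goldenRatio.le
  · refine (wordProb_goldenLaw_append_singleton_le i w b).trans ?_
    rw [List.length_append, List.length_singleton, pow_succ, mul_assoc, sq,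
      inv_mul_cancel_left₀ hφ.ne']
    gcongr
    exact (perronWeight_mem_Icc b).2

theorem real_map_block_singleton {A : Type*} [MeasurableSpace A] [MeasurableSingletonClass A]
    (P : Measure (ℤ → A)) {n : ℕ} (y : Fin n → A) :
    (P.map (block n)).real {y} = wordProb P 1 (List.ofFn y) := by
  rw [map_measureReal_apply (measurable_block n) (measurableSet_singleton y), wordProb,
    List.length_ofFn]
  congr 1
  ext x
  simp [word, List.ofFn_inj, funext_iff, block, timeEmbedding_apply, add_comm (1 : ℤ),
    -List.ofFn_succ]

theorem le_blockEntropy_goldenLaw (n : ℕ) :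
    n * Real.log Real.goldenRatio - 2 * Real.log Real.goldenRatio ≤
      blockEntropy goldenLaw (Finset.Icc 1 (n : ℤ)) := by
  have := Measure.isProbabilityMeasure_map (μ := goldenLaw) (measurable_block n).aemeasurable
  rw [blockEntropy_eq_entropy_map goldenLaw (measurable_block n) fun x y => by
    simp [block, funext_iff, ← map_timeEmbedding_univ]]
  have hentropy := neg_log_le_entropy (goldenLaw.map (block n))
    (c := Real.goldenRatio⁻¹ ^ n * Real.goldenRatio ^ 2) fun y => by
      simpa only [real_map_block_singleton, List.length_ofFn] using
        wordProb_goldenLaw_le 1 (List.ofFn y)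
  rw [Real.log_mul (by positivity) (by positivity), Real.log_pow, Real.log_pow, Real.log_inv]
    at hentropy
  push_cast at hentropy
  linarith

theorem log_goldenRatio_le_blockRate :
    Real.log Real.goldenRatio ≤ blockRate (blockEntropy goldenLaw) :=
  isInput_goldenLaw.isStationaryPolymatroid_blockEntropy.le_blockRate le_blockEntropy_goldenLaw

theorem goldenDefect_goldenLaw (a : Input 2) : goldenDefect goldenLaw a = 0 := by
  have h := wordProb_goldenLaw_append 1 [a] one two
  rw [chainKernel_one_two, coe_goldenParam, mul_comm] at h
  exact sub_eq_zero.2 h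

theorem freeProb_goldenLaw : freeProb goldenLaw = 2 * goldenMass := by
  simp [isInput_goldenLaw.freeProb_eq_sub_goldenDefect, goldenDefect_goldenLaw]

theorem le_infoRate_goldenLaw (ε : unitInterval) :
    Real.log Real.goldenRatio - 2 * Real.log 2 * goldenMass * ε - 2 * (ε : ℝ) ^ 2 ≤
      infoRate goldenLaw ε := by
  have hpoly := isInput_goldenLaw.isStationaryPolymatroid_blockEntropy
  have hrate := hpoly.le_blockRate_erasureMean ε.2
  have hfree := isInput_goldenLaw.blockEntropy_one_two_three_sub_one_three_le
  have hH1 : blockEntropy goldenLaw {1} ≤ 1 := by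
    refine le_trans ?_ log_two_mem_Icc.2
    simpa [card_input] using blockEntropy_singleton_le_log_card goldenLaw 1
  rw [freeProb_goldenLaw] at hfree
  rw [infoRate_eq_blockRate]
  have hfirst := mul_le_mul_of_nonneg_left hfree ε.2.1
  have hsecond := mul_le_mul_of_nonneg_right hH1 (sq_nonneg (ε : ℝ))
  linarith [log_goldenRatio_le_blockRate]

end GoldenChain

section Capacity

theorem goldenLaw_mem_markovRates {m : ℕ} (hm : 1 ≤ m) (ε : unitInterval) :
    infoRate goldenLaw ε ∈ markovRates m rll ε :=
  ⟨goldenLaw, isInput_goldenLaw, isMarkov_goldenLaw hm, rfl⟩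

theorem markovRates_subset_rates {K : ℕ} (m : ℕ) (S : Set (List (Input K))) (ε : unitInterval) :
    markovRates m S ε ⊆ rates S ε := by
  rintro r ⟨P, hP, -, rfl⟩
  exact ⟨P, hP, rfl⟩

theorem goldenLaw_mem_rates (ε : unitInterval) : infoRate goldenLaw ε ∈ rates rll ε :=
  markovRates_subset_rates 1 rll ε (goldenLaw_mem_markovRates le_rfl ε)

theorem bddAbove_rates {K : ℕ} (S : Set (List (Input K))) (ε : unitInterval) :
    BddAbove (rates S ε) := by
  refine ⟨Real.log K, ?_⟩
  rintro r ⟨P, hP, rfl⟩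
  exact hP.infoRate_le_log ε

theorem sSup_rates_sub_expansion_isBigO {R : unitInterval → Set ℝ} (hsub : ∀ ε, R ε ⊆ rates rll ε)
    (hmem : ∀ ε, infoRate goldenLaw ε ∈ R ε) :
    (fun ε : unitInterval => sSup (R ε) - (Real.log Real.goldenRatio -
      2 * Real.log 2 / (1 + Real.goldenRatio ^ 2) * (ε : ℝ))) =O[𝓝 0]
      fun ε : unitInterval => (ε : ℝ) ^ 2 := by
  have hsmall : ∀ᶠ ε : unitInterval in 𝓝 0, (ε : ℝ) < 1 / 2 :=
    (continuous_subtype_val.tendsto (0 : unitInterval)).eventually (gt_mem_nhds (by norm_num))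
  refine IsBigO.of_bound 67 ?_
  filter_upwards [hsmall] with ε hε
  have hupper : sSup (R ε) ≤ Real.log Real.goldenRatio - 2 * Real.log 2 * goldenMass * ε +
      67 * (ε : ℝ) ^ 2 := by
    refine csSup_le ⟨_, hmem ε⟩ fun r hr => ?_
    obtain ⟨P, hP, rfl⟩ := hsub ε hr
    exact hP.infoRate_le_expansion hε.le
  have hlower : Real.log Real.goldenRatio - 2 * Real.log 2 * goldenMass * ε - 2 * (ε : ℝ) ^ 2 ≤
      sSup (R ε) :=
    (le_infoRate_goldenLaw ε).trans (le_csSup ((bddAbove_rates rll ε).mono (hsub ε)) (hmem ε))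
  have hcoef : 2 * Real.log 2 / (1 + Real.goldenRatio ^ 2) = 2 * Real.log 2 * goldenMass := by
    rw [goldenMass, mul_one_div]
  have hsq := sq_nonneg (ε : ℝ)
  rw [hcoef, Real.norm_of_nonneg hsq, Real.norm_eq_abs, abs_le]
  constructor <;> linarith

end Capacity

end

end ErasureChannel

/-- The first three parts say that the quantities are well defined: the limits that define the
mutual information rates exist, and the capacities are suprema of nonempty bounded sets. The last
two parts are the expansions as `ε → 0` within `[0, 1]`. -/
theorem mainTheorem9 :
    (∀ (ε : unitInterval) (P : Measure (ℤ → ErasureChannel.Input 2)),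
      ErasureChannel.IsInput ErasureChannel.rll P →
        Tendsto (fun n : ℕ => ErasureChannel.blockInfo P ε n / n) atTop
          (𝓝 (ErasureChannel.infoRate P ε))) ∧
    (∀ ε : unitInterval,
      (ErasureChannel.rates ErasureChannel.rll ε).Nonempty ∧
        IsLUB (ErasureChannel.rates ErasureChannel.rll ε)
          (ErasureChannel.capacity ErasureChannel.rll ε)) ∧
    (∀ n : ℕ, 1 ≤ n → ∀ ε : unitInterval,
      (ErasureChannel.markovRates n ErasureChannel.rll ε).Nonempty ∧
        IsLUB (ErasureChannel.markovRates n ErasureChannel.rll ε)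
          (ErasureChannel.markovCapacity n ErasureChannel.rll ε)) ∧
    ((fun ε : unitInterval =>
        ErasureChannel.capacity ErasureChannel.rll ε -
          (Real.log Real.goldenRatio -
            2 * Real.log 2 / (1 + Real.goldenRatio ^ 2) * (ε : ℝ)))
      =O[𝓝 0] fun ε : unitInterval => (ε : ℝ) ^ 2) ∧
    (∀ n : ℕ, 1 ≤ n →
      (fun ε : unitInterval =>
        ErasureChannel.markovCapacity n ErasureChannel.rll ε -
          (Real.log Real.goldenRatio -
            2 * Real.log 2 / (1 + Real.goldenRatio ^ 2) * (ε : ℝ)))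
      =O[𝓝 0] fun ε : unitInterval => (ε : ℝ) ^ 2) := by
  refine ⟨fun ε P hP => hP.tendsto_infoRate ε, fun ε => ?_, fun n hn ε => ?_, ?_, fun n hn => ?_⟩
  · have hne := ErasureChannel.goldenLaw_mem_rates ε
    exact ⟨⟨_, hne⟩, isLUB_csSup ⟨_, hne⟩ (ErasureChannel.bddAbove_rates _ ε)⟩
  · have hne := ErasureChannel.goldenLaw_mem_markovRates hn ε
    exact ⟨⟨_, hne⟩, isLUB_csSup ⟨_, hne⟩ ((ErasureChannel.bddAbove_rates _ ε).mono
      (ErasureChannel.markovRates_subset_rates n _ ε))⟩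
  · exact ErasureChannel.sSup_rates_sub_expansion_isBigO (fun _ => subset_rfl)
      ErasureChannel.goldenLaw_mem_rates
  · exact ErasureChannel.sSup_rates_sub_expansion_isBigO
      (ErasureChannel.markovRates_subset_rates n _) (ErasureChannel.goldenLaw_mem_markovRates hn)
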